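/- Theorem (Batch arrivals). For each $N\ge 1$ consider $N$ parallel single-server queues, each with a buffer of size $b$ ($1\le b\le\infty$), and unit-mean exponential service requirements. Batches of $\ell(N)\ge 1$ tasks arrive as a Poisson process of rate $\lambda(N)/\ell(N)$, where $\lambda(N)\ge 0$. Upon each arrival of a batch, $d(N)$ servers are sampled uniformly at random without replacement, $\ell(N)\le d(N)\le N$, and the $\ell(N)$ tasks are assigned, one each, to $\ell(N)$ sampled servers with the smallest queue lengths among the sampled servers (ties are broken arbitrarily); a task assigned to a server with $b$ tasks is discarded. Let $Q_i^N(t)$ be the number of servers with at least $i$ tasks at time $t$, let $q_i^N(t)=Q_i^N(t)/N$, and $\mathbf q^N(t)=(q_1^N(t),q_2^N(t),\dots)$, where $q_i^N\equiv 0$ for $i>b$. Assume that, as $N\to\infty$, $\lambda(N)/N\to\lambda<1$ and $\ell(N)\to\infty$, and, if $\lambda>0$, that also $\ell(N)/N\to 0$. Assume that $d(N)\ge \ell(N)/(1-\lambda-\varepsilon)$ for all large $N$, where $0<\varepsilon<1-\lambda$ is fixed, and that $q_1^N(0)\to q_1^\infty$ in probability for a constant $q_1^\infty\le\lambda$, and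 $q_i^N(0)\to 0$ in probability for every $i\ge 2$. Let $\mathbf q(t)=(q_1(t),q_2(t),\dots)$ with $$q_1(t)=\lambda+(q_1^\infty-\lambda)e^{-t},\qquad q_i(t)\equiv 0\quad\text{for all } i\ge 2 .$$ (a) The processes $\{\mathbf q^N(t)\}_{t\ge 0}$ converge weakly to $\{\mathbf q(t)\}_{t\ge 0}$ with respect to the Skorokhod $J_1$ topology on càdlàg paths, where the occupancy states carry the topology of coordinatewise convergence. (b) If $b<\infty$, or if $b=\infty$ and $\mathbf q^N(0)\to(q_1^\infty,0,0,\dots)$ in $\ell_1$ in probability, then the same weak convergence holds where the occupancy states carry the $\ell_1$ topology. (c) The least number of samples that meets the requirement, $d^*(N)=\lceil \ell(N)/(1-\lambda-\varepsilon)\rceil$, satisfies $\ell(N)\le d^*(N)\le N$ for all large $N$, and its communication overhead per task is $d^*(N)/\ell(N)\to 1/(1-\lambda-\varepsilon)$ as $N\to\infty$, which is $O(1)$. As (a) and (b) cover $d(N)=N$ too, the fluid limit is that of the ordinary JSQ policy, so that fluid-level optimality is achieved with $O(1)$ communication overhead per task. -/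

import Mathlib

open Filter Topology MeasureTheory ProbabilityTheory
open scoped NNReal ENNReal Uniformity

noncomputable section

namespace BatchJSQ

/-! ### Càdlàg paths and the Skorokhod `J₁` topology -/

/-- `x : [0,∞) → E` is right continuous and has left limits. -/
def IsCadlag {E : Type*} [TopologicalSpace E] (x : ℝ≥0 → E) : Prop :=
  ∀ t, ContinuousWithinAt x (Set.Ici t) t ∧ ∃ y, Tendsto x (𝓝[<] t) (𝓝 y)

/-- The space `D_E[0,∞)` of càdlàg paths in `E`. -/
@[ext]
structure SkorokhodSpace (E : Type*) [TopologicalSpace E] where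
  /-- the underlying path -/
  toFun : ℝ≥0 → E
  /-- the path is càdlàg -/
  isCadlag : IsCadlag toFun

instance {E : Type*} [TopologicalSpace E] : CoeFun (SkorokhodSpace E) (fun _ => ℝ≥0 → E) :=
  ⟨SkorokhodSpace.toFun⟩

/-- The image of a càdlàg path under a continuous map. -/
def SkorokhodSpace.map {E F : Type*} [TopologicalSpace E] [TopologicalSpace F] (g : E → F)
    (hg : Continuous g) (x : SkorokhodSpace E) : SkorokhodSpace F where
  toFun t := g (x t)
  isCadlag t := by
    obtain ⟨h, y, hy⟩ := x.isCadlag t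
    exact ⟨hg.continuousAt.comp_continuousWithinAt h, g y, (hg.tendsto y).comp hy⟩

/-- A continuous path, as an element of `D_E[0,∞)`. -/
def SkorokhodSpace.ofContinuous {E : Type*} [TopologicalSpace E] (x : ℝ≥0 → E)
    (hx : Continuous x) : SkorokhodSpace E where
  toFun := x
  isCadlag t := ⟨hx.continuousWithinAt, x t, (hx.tendsto t).mono_left nhdsWithin_le_nhds⟩

/-- Two paths are `(T, ε, U)`-close if, after an increasing bijective change of time `θ` of `[0,∞)`
that moves no point of `[0,T]` by more than `ε`, they are `U`-close on `[0,T]`. -/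
def skorokhodEntourage {E : Type*} [TopologicalSpace E] (T ε : ℝ≥0) (U : Set (E × E)) :
    Set (SkorokhodSpace E × SkorokhodSpace E) :=
  {p | ∃ θ : ℝ≥0 ≃o ℝ≥0, ∀ t ≤ T, dist (θ t) t ≤ ε ∧ (p.1 t, p.2 (θ t)) ∈ U}

theorem skorokhodEntourage_mono {E : Type*} [TopologicalSpace E] {T T' ε ε' : ℝ≥0}
    {U U' : Set (E × E)} (hT : T' ≤ T) (hε : ε ≤ ε') (hU : U ⊆ U') :
    skorokhodEntourage T ε U ⊆ skorokhodEntourage T' ε' U' := by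
  rintro p ⟨θ, hθ⟩
  exact ⟨θ, fun t ht => ⟨(hθ t (ht.trans hT)).1.trans (by exact_mod_cast hε),
    hU (hθ t (ht.trans hT)).2⟩⟩

/-- The filter generated by the sets `skorokhodEntourage T ε U`, with `T ≥ 0`, `ε > 0` and `U` an
entourage of `E`. -/
def skorokhodFilter (E : Type*) [UniformSpace E] :
    Filter (SkorokhodSpace E × SkorokhodSpace E) where
  sets := {S | ∃ T ε : ℝ≥0, 0 < ε ∧ ∃ U ∈ 𝓤 E, skorokhodEntourage T ε U ⊆ S}
  univ_sets := ⟨0, 1, one_pos, Set.univ, univ_mem, Set.subset_univ _⟩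
  sets_of_superset := by
    rintro S S' ⟨T, ε, hε, U, hU, h⟩ hS
    exact ⟨T, ε, hε, U, hU, h.trans hS⟩
  inter_sets := by
    rintro S S' ⟨T, ε, hε, U, hU, h⟩ ⟨T', ε', hε', U', hU', h'⟩
    refine ⟨max T T', min ε ε', lt_min hε hε', U ∩ U', inter_mem hU hU', Set.subset_inter ?_ ?_⟩
    · exact (skorokhodEntourage_mono (le_max_left _ _) (min_le_left _ _)
        Set.inter_subset_left).trans h
    · exact (skorokhodEntourage_mono (le_max_right _ _) (min_le_right _ _)
        Set.inter_subset_right).trans h'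

theorem mem_skorokhodFilter {E : Type*} [UniformSpace E]
    {S : Set (SkorokhodSpace E × SkorokhodSpace E)} :
    S ∈ skorokhodFilter E ↔
      ∃ T ε : ℝ≥0, 0 < ε ∧ ∃ U ∈ 𝓤 E, skorokhodEntourage T ε U ⊆ S := Iff.rfl

theorem skorokhodEntourage_symm {E : Type*} [TopologicalSpace E] {T ε : ℝ≥0} {U V : Set (E × E)}
    (hUV : ∀ a b, (a, b) ∈ U → (b, a) ∈ V) {p : SkorokhodSpace E × SkorokhodSpace E}
    (hp : p ∈ skorokhodEntourage (T + ε) ε U) : p.swap ∈ skorokhodEntourage T ε V := by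
  obtain ⟨θ, hθ⟩ := hp
  refine ⟨θ.symm, fun t ht => ?_⟩
  have hs : θ.symm t ≤ T + ε := by
    by_contra hcon
    have h1 : θ (T + ε) < t := by
      have := θ.strictMono (not_le.mp hcon)
      rwa [OrderIso.apply_symm_apply] at this
    have h2 := (hθ (T + ε) le_rfl).1
    rw [NNReal.dist_eq, abs_le] at h2
    have h3 : ((θ (T + ε) : ℝ≥0) : ℝ) < T := by exact_mod_cast h1.trans_le ht
    have h4 := h2.1
    push_cast at h4
    linarith
  obtain ⟨h1, h2⟩ := hθ _ hs
  rw [OrderIso.apply_symm_apply] at h1 h2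
  exact ⟨by rwa [dist_comm], hUV _ _ h2⟩

theorem skorokhodEntourage_comp {E : Type*} [TopologicalSpace E] {T ε : ℝ≥0} {U V : Set (E × E)}
    (hUV : ∀ a b c, (a, b) ∈ U → (b, c) ∈ U → (a, c) ∈ V) {x y z : SkorokhodSpace E}
    (hxy : (x, y) ∈ skorokhodEntourage (T + ε) (ε / 2) U)
    (hyz : (y, z) ∈ skorokhodEntourage (T + ε) (ε / 2) U) :
    (x, z) ∈ skorokhodEntourage T ε V := by
  obtain ⟨θ, hθ⟩ := hxy
  obtain ⟨η, hη⟩ := hyz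
  refine ⟨θ.trans η, fun t ht => ?_⟩
  obtain ⟨h1, h2⟩ := hθ t (ht.trans le_self_add)
  have hle : θ t ≤ T + ε := by
    have h3 := (abs_le.mp ((NNReal.dist_eq _ _).symm.trans_le h1)).2
    rw [← NNReal.coe_le_coe]
    have h4 : (t : ℝ) ≤ T := by exact_mod_cast ht
    have h5 : (0 : ℝ) ≤ ε := ε.2
    push_cast at h3 ⊢
    linarith
  obtain ⟨h3, h4⟩ := hη _ hle
  refine ⟨?_, hUV _ _ _ h2 h4⟩
  have h5 := dist_triangle (η (θ t)) (θ t) t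
  push_cast at h1 h3
  simp only [OrderIso.trans_apply]
  linarith

/-- The uniform structure of `D_E[0,∞)` whose topology is Skorokhod's `J₁` topology: `xₙ → x` if and
only if for every `T` there are increasing bijections `θₙ` of `[0,∞)` with
`sup_{t ≤ T} |θₙ t - t| → 0` and `x t`, `xₙ (θₙ t)` uniformly close for `t ≤ T` as `n → ∞`. -/
instance {E : Type*} [UniformSpace E] : UniformSpace (SkorokhodSpace E) :=
  UniformSpace.ofCore
    { uniformity := skorokhodFilter E
      refl := by
        rintro S ⟨T, ε, hε, U, hU, h⟩ ⟨x, y⟩ hxy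
        obtain rfl : x = y := by simpa using hxy
        exact h ⟨OrderIso.refl _, fun t _ => ⟨by simp, refl_mem_uniformity hU⟩⟩
      symm := by
        rintro S ⟨T, ε, hε, U, hU, h⟩
        refine ⟨T + ε, ε, hε, Prod.swap ⁻¹' U, symm_le_uniformity hU, fun p hp => h ?_⟩
        exact skorokhodEntourage_symm (fun a b hab => hab) hp
      comp := by
        rintro S ⟨T, ε, hε, U, hU, h⟩
        obtain ⟨V, hV, hVU⟩ := comp_mem_uniformity_sets hU
        refine (Filter.mem_lift'_sets (fun _ _ hst => by gcongr)).2
          ⟨skorokhodEntourage (T + ε) (ε / 2) V,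
            ⟨T + ε, ε / 2, half_pos hε, V, hV, subset_rfl⟩, ?_⟩
        rintro ⟨x, z⟩ ⟨y, hxy, hyz⟩
        exact h (skorokhodEntourage_comp (fun a b c hab hbc => hVU ⟨b, hab, hbc⟩) hxy hyz) }

instance {E : Type*} [UniformSpace E] : MeasurableSpace (SkorokhodSpace E) :=
  borel (SkorokhodSpace E)

instance {E : Type*} [UniformSpace E] : BorelSpace (SkorokhodSpace E) := ⟨rfl⟩

/-- Convergence in probability to a constant, of random elements that may live on different
probability spaces. -/
def TendstoInProb {Ω : ℕ → Type*} [∀ N, MeasurableSpace (Ω N)] (P : ∀ N, Measure (Ω N))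
    {E : Type*} [PseudoMetricSpace E] (Y : ∀ N, Ω N → E) (c : E) : Prop :=
  ∀ δ : ℝ, 0 < δ → Tendsto (fun N => P N {ω | δ ≤ dist (Y N ω) c}) atTop (𝓝 0)

/-! ### The system -/

/-- `B` consists of `ℓ` servers with the smallest queue lengths among the sampled servers `S`;
`x j` is the queue length of server `j`. -/
def IsShortestSelection {N : ℕ} (ℓ : ℕ) (x : Fin N → ℕ) (S B : Finset (Fin N)) : Prop :=
  B ⊆ S ∧ B.card = ℓ ∧ ∀ i ∈ B, ∀ j ∈ S \ B, x i ≤ x j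

/-- Every server in `B` receives one task; a task sent to a full buffer is discarded. -/
def addBatch {N : ℕ} (b : ℕ∞) (x : Fin N → ℕ) (B : Finset (Fin N)) : Fin N → ℕ :=
  fun j => if j ∈ B ∧ (x j : ℕ∞) < b then x j + 1 else x j

/-- Server `j` completes a task. -/
def removeTask {N : ℕ} (x : Fin N → ℕ) (j : Fin N) : Fin N → ℕ :=
  Function.update x j (x j - 1)

/-- The generator of the Markov process of the `N` queue lengths. Every nonempty queue completes
tasks at rate one. Batches of `ℓ` tasks arrive at rate `rate / ℓ`; upon an arrival a set `S` of `d`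
servers is drawn uniformly at random, without replacement, and the tasks are assigned, one each, to
the servers of a set `B` with law `sel x S`, by which ties are broken. -/
def batchGenerator {N : ℕ} (ℓ d : ℕ) (b : ℕ∞) (rate : ℝ)
    (sel : (Fin N → ℕ) → Finset (Fin N) → PMF (Finset (Fin N)))
    (f : (Fin N → ℕ) → ℝ) (x : Fin N → ℕ) : ℝ :=
  (∑ j with 0 < x j, (f (removeTask x j) - f x)) +
    rate / ℓ * ((N.choose d : ℝ)⁻¹ * ∑ S ∈ Finset.powersetCard d Finset.univ,
      ∑ B : Finset (Fin N), (sel x S B).toReal * (f (addBatch b x B) - f x))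

/-- `X` is (a càdlàg version of) the vector of queue lengths in the system of `N` servers with
buffer size `b`, batch size `ℓ`, total task arrival rate `rate` and the JSQ(`d`) scheme for batches:
the Markov jump process in `{x | x j ≤ b}` with generator `batchGenerator`, that is, the solution of
the martingale problem for this (bounded) generator. Ties may be broken in any, possibly random,
way; the initial state may be random. -/
def IsBatchJSQProcess {Ω : Type*} [mΩ : MeasurableSpace Ω] (P : Measure Ω) (N ℓ d : ℕ) (b : ℕ∞)
    (rate : ℝ) (X : Ω → SkorokhodSpace (Fin N → ℕ)) : Prop :=
  (∀ ω t j, (X ω t j : ℕ∞) ≤ b) ∧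
  ∃ (sel : (Fin N → ℕ) → Finset (Fin N) → PMF (Finset (Fin N))) (ℱ : Filtration ℝ≥0 mΩ),
    (∀ x S, S.card = d → ∀ B ∈ (sel x S).support, IsShortestSelection ℓ x S B) ∧
    (∀ t, Measurable[ℱ t] fun ω => X ω t) ∧
    ∀ f : (Fin N → ℕ) → ℝ, (∃ C, ∀ x, |f x| ≤ C) →
      Martingale (fun (t : ℝ≥0) ω => f (X ω t) -
        ∫ s in (0 : ℝ)..t, batchGenerator ℓ d b rate sel f (X ω s.toNNReal)) ℱ P

/-- `Q_i`: the number of servers with queue length at least `i`. -/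
def occupancy {N : ℕ} (x : Fin N → ℕ) (i : ℕ) : ℕ :=
  (Finset.univ.filter fun j => i ≤ x j).card

/-- `q_i = Q_i / N`. -/
def fluidOccupancy {N : ℕ} (x : Fin N → ℕ) (i : ℕ) : ℝ := (occupancy x i : ℝ) / N

/-- The occupancy state `(q_1, q_2, …)` as a sequence; `q_i = 0` for `i > b`. -/
def fluidState {N : ℕ} (x : Fin N → ℕ) : ℕ → ℝ := fun k => fluidOccupancy x (k + 1)

theorem memℓp_fluidState {N : ℕ} (x : Fin N → ℕ) : Memℓp (fluidState x) 1 := by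
  refine memℓp_gen ?_
  refine summable_of_ne_finset_zero (s := Finset.range (∑ j, x j)) fun k hk => ?_
  have h0 : occupancy x (k + 1) = 0 := by
    refine Finset.card_eq_zero.2 (Finset.filter_eq_empty_iff.2 fun j _ hj => hk ?_)
    have := Finset.single_le_sum (f := x) (fun _ _ => Nat.zero_le _) (Finset.mem_univ j)
    rw [Finset.mem_range]
    lia
  simp [fluidState, fluidOccupancy, h0]

/-- The occupancy state `(q_1, q_2, …)` as an element of `ℓ₁`. -/
def fluidStateL1 {N : ℕ} (x : Fin N → ℕ) : lp (fun _ : ℕ => ℝ) 1 :=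
  ⟨fluidState x, memℓp_fluidState x⟩

/-- The fluid-scaled occupancy process, with values in sequences with the product topology. -/
def fluidPath {N : ℕ} (x : SkorokhodSpace (Fin N → ℕ)) : SkorokhodSpace (ℕ → ℝ) :=
  x.map fluidState continuous_of_discreteTopology

/-- The fluid-scaled occupancy process, with values in `ℓ₁`. -/
def fluidPathL1 {N : ℕ} (x : SkorokhodSpace (Fin N → ℕ)) :
    SkorokhodSpace (lp (fun _ : ℕ => ℝ) 1) :=
  x.map fluidStateL1 continuous_of_discreteTopology

/-- The fluid limit of the first coordinate, `q_1(t) = λ + (q_1^∞ - λ) e^{-t}`. -/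
def limitQ1 (lam q₁ : ℝ) (t : ℝ≥0) : ℝ := lam + (q₁ - lam) * Real.exp (-(t : ℝ))

theorem continuous_limitQ1 (lam q₁ : ℝ) : Continuous (limitQ1 lam q₁) := by
  unfold limitQ1
  fun_prop

/-- The fluid limit `(q_1(t), 0, 0, …)`, with values in sequences with the product topology. -/
def limitPath (lam q₁ : ℝ) : SkorokhodSpace (ℕ → ℝ) :=
  .ofContinuous (fun t k => if k = 0 then limitQ1 lam q₁ t else 0) <| by
    refine continuous_pi fun k => ?_
    split_ifs
    · exact continuous_limitQ1 lam q₁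
    · exact continuous_const

/-- The fluid limit `(q_1(t), 0, 0, …)`, with values in `ℓ₁`. -/
def limitPathL1 (lam q₁ : ℝ) : SkorokhodSpace (lp (fun _ : ℕ => ℝ) 1) :=
  .ofContinuous (fun t => lp.single 1 0 (limitQ1 lam q₁ t)) <|
    (lp.isometry_single (E := fun _ : ℕ => ℝ) (p := 1) 0).continuous.comp
      (continuous_limitQ1 lam q₁)

end BatchJSQ

end

/-!
The fluid limit rests on the fact that the fraction `q₁` of busy servers stays below
`λ + ε / 2 < 1`. While it does, a sample of `d ≥ ℓ / (1 - λ - ε)` servers contains on average at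
least `(1 + c) ℓ` idle ones, for a constant `c > 0`. As the number of idle servers in the sample is
hypergeometric, with variance at most its mean, Chebyshev's inequality shows that the mean number of
tasks of a batch that do not find an idle server is bounded by a constant
(`sampleMean_shortage_le`). Since batches arrive at rate `rate / ℓ` and `ℓ → ∞`, the rate at which
waiting tasks are created is `o(N)` (`batchGenerator_waiting_le`), and the drift of `q₁` is
`λ - q₁ + o(1)` up to the fraction `q₂` of servers with a waiting task
(`abs_batchGenerator_busy_sub_le`).

The random fluctuations are controlled by the martingale problem. For an average `f` over the servers
the carré du champ `L f² - 2 f L f` is at most `1 / N + (rate / N) (ℓ / N)`, which tends to `0`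
(`batchGenerator_sq_sub_le`); it bounds the second moment of the compensated process
(`integral_sq_compensated_le`), and Doob's maximal inequality makes this uniform on `[0, T]`
(`measure_exists_lt_abs_le`). On the event that the fluctuations and the initial deviations are
small, everything else is deterministic: up to and including the first time at which `q₁` exceeds
`λ + ε / 2`, Gronwall's inequality keeps `q₁` close to the solution of `q' = λ - q`, which stays
below `λ`, so this time is never reached (`abs_sub_limit_le`).

For the `ℓ₁` topology the number of waiting tasks per server is truncated at a level `K`. The bounds
do not depend on `K`, apart from the initial state, so that `K → ∞` is possible by monotone
convergence.

Since the limit is deterministic and continuous, convergence in distribution follows from uniform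
convergence on compact time intervals in probability
(`tendstoInDistribution_of_forall_entourage`). The Borel measurability of the paths for the `J₁`
topology comes from an approximation by step paths (`measurable_map_of_forall_measurable`).
-/

noncomputable section

namespace BatchJSQ

/-! ### The Skorokhod space -/

theorem uniformity_skorokhodSpace (E : Type*) [UniformSpace E] :
    𝓤 (SkorokhodSpace E) = skorokhodFilter E := rfl

instance {E : Type*} [UniformSpace E] [(𝓤 E).IsCountablyGenerated] :
    (𝓤 (SkorokhodSpace E)).IsCountablyGenerated := by
  obtain ⟨U, hU⟩ := (𝓤 E).exists_antitone_basis
  have : (𝓤 (SkorokhodSpace E)).HasBasis (fun _ : ℕ => True)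
      fun n => skorokhodEntourage (n : ℝ≥0) ((n : ℝ≥0) + 1)⁻¹ (U n) := by
    refine ⟨fun S => ?_⟩
    rw [uniformity_skorokhodSpace, mem_skorokhodFilter]
    constructor
    · rintro ⟨T, ε, hε, V, hV, h⟩
      obtain ⟨n₁, -, h₁⟩ := hU.1.mem_iff.1 hV
      obtain ⟨n₂, h₂⟩ := exists_nat_ge T
      obtain ⟨n₃, h₃⟩ := exists_nat_ge ε⁻¹
      refine ⟨max n₁ (max n₂ n₃), trivial, (skorokhodEntourage_mono ?_ ?_ ?_).trans h⟩
      · exact h₂.trans (by exact_mod_cast (le_max_left n₂ n₃).trans (le_max_right _ _))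
      · refine inv_le_of_inv_le₀ hε (h₃.trans ?_)
        exact_mod_cast ((le_max_right n₂ n₃).trans (le_max_right n₁ _)).trans (Nat.le_succ _)
      · exact (hU.2 (le_max_left _ _)).trans h₁
    · rintro ⟨n, -, h⟩
      exact ⟨n, _, by positivity, U n, hU.1.mem_of_mem trivial, h⟩
  exact this.isCountablyGenerated

/-- Convergence in probability to a constant, in the uniform structure, implies convergence in
distribution to that constant. -/
theorem tendstoInDistribution_of_forall_entourage {Ω : ℕ → Type*} [∀ N, MeasurableSpace (Ω N)]
    (P : ∀ N, Measure (Ω N)) [∀ N, IsProbabilityMeasure (P N)] {E : Type*} [UniformSpace E]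
    [(𝓤 E).IsCountablyGenerated] [MeasurableSpace E] [BorelSpace E] {Y : ∀ N, Ω N → E} {c : E}
    (hY : ∀ N, Measurable (Y N))
    (h : ∀ U ∈ 𝓤 E, Tendsto (fun N => P N {ω | (c, Y N ω) ∉ U}) atTop (𝓝 0)) :
    TendstoInDistribution Y atTop (fun _ : Unit => c) P (Measure.dirac ()) where
  forall_aemeasurable N := (hY N).aemeasurable
  tendsto := by
    let _ : PseudoMetricSpace E := UniformSpace.pseudoMetricSpace E
    refine tendsto_of_forall_isOpen_le_liminf fun G hG => ?_
    have hG' := hG.measurableSet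
    by_cases hc : c ∈ G
    · obtain ⟨U, hU, hUG⟩ := UniformSpace.mem_nhds_iff.1 (hG.mem_nhds hc)
      have h1 : Tendsto (fun N => (P N).map (Y N) G) atTop (𝓝 1) := by
        have h2 : Tendsto (fun N => (P N).map (Y N) Gᶜ) atTop (𝓝 0) := by
          refine tendsto_of_tendsto_of_tendsto_of_le_of_le tendsto_const_nhds (h U hU)
            (fun N => zero_le) fun N => ?_
          rw [Measure.map_apply (hY N) hG'.compl]
          exact measure_mono fun ω hω hcon => hω (hUG hcon)
        have h3 : Tendsto (fun N => 1 - (P N).map (Y N) Gᶜ) atTop (𝓝 (1 - 0)) :=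
          ENNReal.Tendsto.sub tendsto_const_nhds h2 (Or.inl ENNReal.one_ne_top)
        rw [tsub_zero] at h3
        refine h3.congr fun N => ?_
        have := Measure.isProbabilityMeasure_map (μ := P N) (hY N).aemeasurable
        rw [prob_compl_eq_one_sub hG', ENNReal.sub_sub_cancel ENNReal.one_ne_top prob_le_one]
      have h4 : Tendsto (fun N => ((P N).map (Y N) G).toNNReal) atTop (𝓝 1) :=
        (ENNReal.tendsto_toNNReal ENNReal.one_ne_top).comp h1
      exact (ProbabilityMeasure.apply_le_one _ _).trans h4.liminf_eq.ge
    · refine le_of_eq_of_le ?_ zero_le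
      change (Measure.map (fun _ : Unit => c) (Measure.dirac ()) G).toNNReal = 0
      rw [Measure.map_const, measure_univ, one_smul, Measure.dirac_apply' _ hG']
      simp [hc]

/-- Finitely many positive times can be moved, by small amounts, by an increasing bijection of
`[0,∞)` that is uniformly close to the identity. -/
theorem exists_orderIso_apply_eq (F : Finset ℝ≥0) (hF : ∀ τ ∈ F, 0 < τ) {ε : ℝ≥0} (hε : 0 < ε) :
    ∃ δ : ℝ, 0 < δ ∧ ∀ s : ℝ≥0 → ℝ≥0, (∀ τ ∈ F, dist (s τ) τ ≤ δ) →
      ∃ θ : ℝ≥0 ≃o ℝ≥0, (∀ τ ∈ F, θ τ = s τ) ∧ ∀ t, dist (θ t) t ≤ ε := by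
  -- `η` separates the given times from each other and from `0`
  obtain ⟨η, hη, hη1, hη2⟩ : ∃ η : ℝ, 0 < η ∧ (∀ τ ∈ F, η ≤ τ) ∧
      ∀ τ ∈ F, ∀ τ' ∈ F, τ' ≠ τ → η ≤ |(τ' : ℝ) - τ| := by
    have hev : ∀ c : ℝ, 0 < c → ∀ᶠ η in 𝓝[>] (0 : ℝ), η ≤ c := fun c hc =>
      nhdsWithin_le_nhds (eventually_le_nhds hc)
    have h1 : ∀ᶠ η in 𝓝[>] (0 : ℝ), ∀ τ ∈ F, η ≤ (τ : ℝ) :=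
      (eventually_all_finset F).2 fun τ hτ => hev _ (by exact_mod_cast hF τ hτ)
    have h2 : ∀ᶠ η in 𝓝[>] (0 : ℝ), ∀ τ ∈ F, ∀ τ' ∈ F, τ' ≠ τ → η ≤ |(τ' : ℝ) - τ| := by
      refine (eventually_all_finset F).2 fun τ _ => (eventually_all_finset F).2 fun τ' _ => ?_
      by_cases h : τ' = τ
      · simp [h]
      · refine (hev |(τ' : ℝ) - τ| ?_).mono fun η hη _ => hη
        exact abs_pos.2 (sub_ne_zero.2 (by exact_mod_cast h))
    obtain ⟨η, h⟩ := ((eventually_mem_nhdsWithin.and h1).and h2).exists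
    exact ⟨η, h.1.1, h.1.2, h.2⟩
  have hε' : (0 : ℝ) < ε := by exact_mod_cast hε
  set m : ℝ := F.card + 1 with hm
  have hm0 : 0 < m := by positivity
  refine ⟨min (η / 2) ε / m, by positivity, fun s hs => ?_⟩
  set δ := min (η / 2) (ε : ℝ) / m with hδ
  have hδ0 : 0 < δ := by positivity
  have hcard : F.card * δ ≤ min (η / 2) ε := by
    have : m * δ = min (η / 2) (ε : ℝ) := by rw [hδ]; field_simp
    nlinarith
  let bump : ℝ≥0 → ℝ → ℝ := fun τ t => max 0 (1 - |t - τ| / η)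
  let g : ℝ → ℝ := fun t => t + ∑ τ ∈ F, ((s τ : ℝ) - τ) * bump τ t
  have hb0 : ∀ τ t, 0 ≤ bump τ t := fun τ t => le_max_left _ _
  have hb1 : ∀ τ t, bump τ t ≤ 1 := fun τ t => by
    refine max_le zero_le_one ?_
    have : 0 ≤ |t - τ| / η := by positivity
    linarith
  have hbL : ∀ τ t u, |bump τ t - bump τ u| ≤ |t - u| / η := fun τ t u => by
    refine (abs_max_sub_max_le_max 0 (1 - |t - τ| / η) 0 (1 - |u - τ| / η)).trans ?_
    rw [sub_self, abs_zero, max_eq_right (abs_nonneg _)]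
    have h1 := abs_abs_sub_abs_le_abs_sub (u - τ) (t - τ)
    have h2 : (1 - |t - τ| / η) - (1 - |u - τ| / η) = (|u - τ| - |t - τ|) / η := by ring
    rw [h2, abs_div, abs_of_pos hη]
    refine div_le_div_of_nonneg_right ?_ hη.le
    calc _ ≤ _ := h1
      _ = |t - u| := by rw [abs_sub_comm]; congr 1; ring
  have hsum : ∀ c : ℝ≥0 → ℝ, ∀ B, (∀ τ, |c τ| ≤ B) →
      |∑ τ ∈ F, ((s τ : ℝ) - τ) * c τ| ≤ F.card * δ * B := fun c B hc => by
    refine (Finset.abs_sum_le_sum_abs _ _).trans ?_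
    calc ∑ τ ∈ F, |((s τ : ℝ) - τ) * c τ| ≤ ∑ τ ∈ F, δ * B := by
          refine Finset.sum_le_sum fun τ hτ => ?_
          rw [abs_mul]
          have := hs τ hτ
          rw [NNReal.dist_eq] at this
          exact mul_le_mul this (hc τ) (abs_nonneg _) hδ0.le
      _ = F.card * δ * B := by rw [Finset.sum_const, nsmul_eq_mul]; ring
  have hgmono : StrictMono g := fun t u htu => by
    have h1 := hsum (fun τ => bump τ u - bump τ t) (|u - t| / η) fun τ => hbL τ u t
    have h2 : F.card * δ * (|u - t| / η) ≤ (u - t) / 2 := by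
      rw [abs_of_pos (sub_pos.2 htu)]
      calc F.card * δ * ((u - t) / η) ≤ (η / 2) * ((u - t) / η) := by
            have : 0 < (u - t) / η := div_pos (sub_pos.2 htu) hη
            gcongr
            exact hcard.trans (min_le_left _ _)
        _ = (u - t) / 2 := by field_simp
    have h3 : g u - g t = (u - t) + ∑ τ ∈ F, ((s τ : ℝ) - τ) * (bump τ u - bump τ t) := by
      simp only [g, mul_sub, Finset.sum_sub_distrib]
      ring
    have h4 := (abs_le.1 (h1.trans h2)).1
    have : 0 < g u - g t := by rw [h3]; linarith
    linarith
  have hgdist : ∀ t, |g t - t| ≤ ε := fun t => by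
    have h1 := hsum (fun τ => bump τ t) 1 fun τ => by
      rw [abs_of_nonneg (hb0 τ t)]; exact hb1 τ t
    have h2 : g t - t = ∑ τ ∈ F, ((s τ : ℝ) - τ) * bump τ t := by simp [g]
    rw [h2]
    linarith [hcard.trans (min_le_right _ _)]
  have hgzero : g 0 = 0 := by
    have : ∀ τ ∈ F, ((s τ : ℝ) - τ) * bump τ 0 = 0 := fun τ hτ => by
      have : bump τ 0 = 0 := by
        refine max_eq_left ?_
        rw [zero_sub, abs_neg, abs_of_nonneg (NNReal.coe_nonneg τ), sub_nonpos, one_le_div hη]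
        exact hη1 τ hτ
      rw [this, mul_zero]
    simp [g, Finset.sum_eq_zero this]
  have hgcont : Continuous g := by fun_prop
  have hgnonneg : ∀ t : ℝ≥0, 0 ≤ g t := fun t => by
    rw [← hgzero]; exact hgmono.monotone t.2
  let θ₀ : ℝ≥0 → ℝ≥0 := fun t => ⟨g t, hgnonneg t⟩
  have hθmono : StrictMono θ₀ := fun t u htu => hgmono (by exact_mod_cast htu)
  have hθsurj : Function.Surjective θ₀ := fun y => by
    have h1 : (y : ℝ) ∈ Set.Icc (g 0) (g (y + ε)) := by
      refine ⟨by rw [hgzero]; exact y.2, ?_⟩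
      have := (abs_le.1 (hgdist (y + ε))).1
      linarith
    obtain ⟨t, ht, hgt⟩ := intermediate_value_Icc (by positivity) hgcont.continuousOn h1
    exact ⟨⟨t, ht.1⟩, NNReal.eq hgt⟩
  refine ⟨hθmono.orderIsoOfSurjective _ hθsurj, fun τ hτ => NNReal.eq ?_, fun t => ?_⟩
  · change g τ = s τ
    have h1 : ∑ τ' ∈ F, ((s τ' : ℝ) - τ') * bump τ' τ = (s τ : ℝ) - τ := by
      rw [Finset.sum_eq_single_of_mem τ hτ]
      · simp [bump]
      · intro τ' hτ' hne
        have : bump τ' τ = 0 := by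
          refine max_eq_left ?_
          rw [sub_nonpos, one_le_div hη, abs_sub_comm]
          exact hη2 τ hτ τ' hτ' hne
        rw [this, mul_zero]
    simp [g, h1]
  · rw [NNReal.dist_eq]
    exact hgdist t

/-- A càdlàg path in a discrete space has finitely many jumps in a bounded time interval. -/
theorem SkorokhodSpace.exists_finset_jumps {E : Type*} [TopologicalSpace E] [DiscreteTopology E]
    (x : SkorokhodSpace E) (T : ℝ≥0) :
    ∃ F : Finset ℝ≥0, (∀ τ ∈ F, 0 < τ) ∧
      ∀ t ≤ T, ∀ u ≤ T, (∀ τ ∈ F, τ ≤ t ↔ τ ≤ u) → x t = x u := by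
  have hloc : ∀ c : ℝ≥0, ∃ V : Set ℝ≥0, IsOpen V ∧ c ∈ V ∧
      ∀ t ∈ V, ∀ u ∈ V, (c ≤ t ↔ c ≤ u) → x t = x u := fun c => by
    obtain ⟨h1, y, h2⟩ := x.isCadlag c
    rw [nhds_discrete, tendsto_pure] at h2
    have h1' : ∀ᶠ s in 𝓝[≥] c, x s = x c := by
      have : Tendsto x (𝓝[≥] c) (𝓝 (x c)) := h1
      rwa [nhds_discrete, tendsto_pure] at this
    have h3 : ∀ᶠ s in 𝓝 c, (c ≤ s → x s = x c) ∧ (s < c → x s = y) :=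
      (eventually_nhdsWithin_iff.1 h1').and (eventually_nhdsWithin_iff.1 h2)
    obtain ⟨V, hV, hVo, hcV⟩ := mem_nhds_iff.1 h3
    refine ⟨V, hVo, hcV, fun t ht u hu htu => ?_⟩
    by_cases hct : c ≤ t
    · rw [(hV ht).1 hct, (hV hu).1 (htu.1 hct)]
    · rw [(hV ht).2 (not_le.1 hct), (hV hu).2 (not_le.1 (htu.not.1 hct))]
  choose V hVo hcV hV using hloc
  obtain ⟨C, hC⟩ := (isCompact_Icc (a := (0 : ℝ≥0)) (b := T)).elim_finite_subcover V hVo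
    fun c _ => Set.mem_iUnion.2 ⟨c, hcV c⟩
  obtain ⟨δ, hδ, hball⟩ := lebesgue_number_lemma_of_metric
    (isCompact_Icc (a := (0 : ℝ≥0)) (b := T)) (c := fun c : C => V c) (fun c => hVo c)
    (fun t ht => by simpa using hC ht)
  -- the centres of the covering sets, and a grid finer than the Lebesgue number of the cover
  lift δ to ℝ≥0 using hδ.le
  have hδ' : 0 < δ := by exact_mod_cast hδ
  let K := ⌊T / δ⌋₊ + 2
  refine ⟨(C ∪ (Finset.range K).image fun k : ℕ => (k : ℝ≥0) * δ).filter (0 < ·),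
    fun τ hτ => (Finset.mem_filter.1 hτ).2, fun t ht u hu h => ?_⟩
  have hside : ∀ τ, τ ∈ C ∪ (Finset.range K).image (fun k : ℕ => (k : ℝ≥0) * δ) →
      (τ ≤ t ↔ τ ≤ u) := fun τ hτ => by
    rcases eq_zero_or_pos τ with rfl | hpos
    · simp
    · exact h τ (Finset.mem_filter.2 ⟨hτ, hpos⟩)
  have hgrid : ∀ k : ℕ, k < K → ((k : ℝ≥0) * δ ≤ t ↔ (k : ℝ≥0) * δ ≤ u) := fun k hk =>
    hside _ (Finset.mem_union_right _ (Finset.mem_image.2 ⟨k, Finset.mem_range.2 hk, rfl⟩))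
  have hdist : dist u t < δ := by
    set k := ⌊t / δ⌋₊ with hk
    have hkK : k + 1 < K := by
      have : k ≤ ⌊T / δ⌋₊ := Nat.floor_le_floor (by gcongr)
      lia
    have h1 : (k : ℝ≥0) * δ ≤ t := (le_div_iff₀ hδ').1 (Nat.floor_le zero_le)
    have h2 : t < ((k + 1 : ℕ) : ℝ≥0) * δ := by
      refine (div_lt_iff₀ hδ').1 ?_
      exact_mod_cast Nat.lt_floor_add_one (t / δ)
    have h3 := (hgrid k (by lia)).1 h1
    have h4 := (hgrid (k + 1) hkK).not.1 (not_le.2 h2)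
    rw [not_le] at h4
    rw [NNReal.dist_eq, abs_lt]
    have h1' : (k : ℝ) * δ ≤ t := by exact_mod_cast h1
    have h2' : (t : ℝ) < ((k : ℝ) + 1) * δ := by exact_mod_cast h2
    have h3' : (k : ℝ) * δ ≤ u := by exact_mod_cast h3
    have h4' : (u : ℝ) < ((k : ℝ) + 1) * δ := by exact_mod_cast h4
    constructor <;> nlinarith
  obtain ⟨c, hc⟩ := hball t ⟨zero_le, ht⟩
  exact hV c t (hc (Metric.mem_ball_self hδ)) u (hc hdist)
    (hside c (Finset.mem_union_left _ c.2))

/-- The path that equals `a k` on `[k/(n+1), (k+1)/(n+1))`. -/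
def stepPath {E : Type*} [TopologicalSpace E] (n : ℕ) (a : ℕ → E) : SkorokhodSpace E where
  toFun t := a ⌊((n : ℝ≥0) + 1) * t⌋₊
  isCadlag t := by
    have hn : (0 : ℝ≥0) < (n : ℝ≥0) + 1 := by positivity
    constructor
    · refine tendsto_nhds_of_eventually_eq ?_
      set k := ⌊((n : ℝ≥0) + 1) * t⌋₊ with hk
      have h1 : t < ((k : ℝ≥0) + 1) / ((n : ℝ≥0) + 1) := by
        rw [lt_div_iff₀' hn]
        exact Nat.lt_floor_add_one _
      filter_upwards [self_mem_nhdsWithin, nhdsWithin_le_nhds (eventually_lt_nhds h1)] with s hs hs'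
      congr 1
      rw [Nat.floor_eq_iff zero_le]
      exact ⟨(Nat.floor_le zero_le).trans (by gcongr; exact hs), (lt_div_iff₀' hn).1 hs'⟩
    · rcases eq_zero_or_pos t with rfl | ht
      · refine ⟨a 0, ?_⟩
        have : 𝓝[<] (0 : ℝ≥0) = ⊥ := by
          have h0 : Set.Iio (0 : ℝ≥0) = ∅ := by ext; simp
          rw [h0, nhdsWithin_empty]
        rw [this]
        exact tendsto_bot
      · obtain ⟨k, hk⟩ : ∃ k, ⌈((n : ℝ≥0) + 1) * t⌉₊ = k + 1 :=
          Nat.exists_eq_succ_of_ne_zero (Nat.ceil_pos.2 (by positivity)).ne'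
        refine ⟨a k, tendsto_nhds_of_eventually_eq ?_⟩
        have h1 : (k : ℝ≥0) / ((n : ℝ≥0) + 1) < t := by
          rw [div_lt_iff₀' hn]
          exact Nat.lt_ceil.1 (by lia)
        filter_upwards [self_mem_nhdsWithin, nhdsWithin_le_nhds (eventually_gt_nhds h1)]
          with s hs hs'
        congr 1
        rw [Nat.floor_eq_iff zero_le]
        refine ⟨((div_lt_iff₀' hn).1 hs').le, ?_⟩
        calc ((n : ℝ≥0) + 1) * s < ((n : ℝ≥0) + 1) * t := by gcongr; exact hs
          _ ≤ _ := by exact_mod_cast hk ▸ Nat.le_ceil (((n : ℝ≥0) + 1) * t)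

/-- A path that is the image of a path in a discrete space is the `J₁` limit of its
discretizations. The time change sends every jump to the next grid point. -/
theorem SkorokhodSpace.tendsto_stepPath {E F : Type*} [TopologicalSpace E] [DiscreteTopology E]
    [UniformSpace F] (g : E → F) (x : SkorokhodSpace E) :
    Tendsto (fun n : ℕ => stepPath n fun k => g (x (k / ((n : ℝ≥0) + 1)))) atTop
      (𝓝 (x.map g continuous_of_discreteTopology)) := by
  rw [Uniform.tendsto_nhds_right, uniformity_skorokhodSpace]
  rintro S ⟨T, ε, hε, U, hU, hS⟩
  obtain ⟨F, hF, hx⟩ := x.exists_finset_jumps (T + ε)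
  obtain ⟨δ, hδ, hθ⟩ := exists_orderIso_apply_eq F hF hε
  obtain ⟨n₀, hn₀⟩ := exists_nat_ge δ⁻¹
  rw [mem_map]
  filter_upwards [eventually_ge_atTop n₀] with n hn
  refine hS ?_
  have hn0 : (0 : ℝ≥0) < (n : ℝ≥0) + 1 := by positivity
  have hn1 : ((n : ℝ) + 1)⁻¹ ≤ δ := by
    refine inv_le_of_inv_le₀ hδ (hn₀.trans ?_)
    exact_mod_cast hn.trans (Nat.le_succ n)
  obtain ⟨θ, hθ1, hθ2⟩ := hθ (fun τ => ⌈((n : ℝ≥0) + 1) * τ⌉₊ / ((n : ℝ≥0) + 1)) fun τ _ => by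
    refine le_trans ?_ hn1
    have hn0' : (0 : ℝ) < (n : ℝ) + 1 := by positivity
    have h1 : ((n : ℝ) + 1) * τ ≤ ⌈((n : ℝ≥0) + 1) * τ⌉₊ := by
      exact_mod_cast Nat.le_ceil (((n : ℝ≥0) + 1) * τ)
    have h2 : (⌈((n : ℝ≥0) + 1) * τ⌉₊ : ℝ) < ((n : ℝ) + 1) * τ + 1 := by
      exact_mod_cast Nat.ceil_lt_add_one (a := ((n : ℝ≥0) + 1) * τ) zero_le
    have h3 : (⌈((n : ℝ≥0) + 1) * τ⌉₊ : ℝ) / ((n : ℝ) + 1) - τ =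
        (⌈((n : ℝ≥0) + 1) * τ⌉₊ - ((n : ℝ) + 1) * τ) * ((n : ℝ) + 1)⁻¹ := by field_simp
    rw [NNReal.dist_eq]
    push_cast
    rw [h3, abs_mul, abs_of_nonneg (sub_nonneg.2 h1), abs_of_pos (inv_pos.2 hn0')]
    exact mul_le_of_le_one_left (by positivity) (by linarith)
  refine ⟨θ, fun t ht => ⟨hθ2 t, ?_⟩⟩
  have hle : (⌊((n : ℝ≥0) + 1) * θ t⌋₊ : ℝ≥0) / ((n : ℝ≥0) + 1) ≤ θ t := by
    rw [div_le_iff₀' hn0]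
    exact Nat.floor_le zero_le
  have hθT : θ t ≤ T + ε := by
    have := (abs_le.1 ((NNReal.dist_eq _ _).symm.trans_le (hθ2 t))).2
    have h' : (t : ℝ) ≤ T := by exact_mod_cast ht
    have h'' : ((θ t : ℝ≥0) : ℝ) ≤ T + ε := by linarith
    exact_mod_cast h''
  have heq : x t = x (⌊((n : ℝ≥0) + 1) * θ t⌋₊ / ((n : ℝ≥0) + 1)) := by
    refine hx t (ht.trans le_self_add) _ (hle.trans hθT) fun τ hτ => ?_
    rw [← θ.le_iff_le, hθ1 τ hτ, div_le_iff₀' hn0, le_div_iff₀' hn0, ← Nat.le_floor_iff zero_le,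
      Nat.ceil_le]
  change (g (x t), g (x (⌊((n : ℝ≥0) + 1) * θ t⌋₊ / ((n : ℝ≥0) + 1)))) ∈ U
  rw [← heq]
  exact refl_mem_uniformity hU

theorem continuous_stepPath {E F : Type*} [TopologicalSpace E] [DiscreteTopology E]
    [UniformSpace F] (g : E → F) (n : ℕ) :
    Continuous fun a : ℕ → E => stepPath n fun k => g (a k) := by
  refine continuous_iff_continuousAt.2 fun a => ?_
  rw [ContinuousAt, Uniform.tendsto_nhds_right, uniformity_skorokhodSpace]
  rintro S ⟨T, ε, hε, U, hU, hS⟩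
  have h1 : ∀ᶠ a' in 𝓝 a, ∀ k ∈ Finset.range (⌊((n : ℝ≥0) + 1) * T⌋₊ + 1), a' k = a k := by
    refine (eventually_all_finset _).2 fun k _ => ?_
    have : Tendsto (fun a' : ℕ → E => a' k) (𝓝 a) (𝓝 (a k)) := (continuous_apply k).tendsto a
    rwa [nhds_discrete E, tendsto_pure] at this
  rw [mem_map]
  filter_upwards [h1] with a' ha'
  refine hS ⟨OrderIso.refl _, fun t ht => ⟨by simp, ?_⟩⟩
  change (g (a ⌊((n : ℝ≥0) + 1) * t⌋₊), g (a' ⌊((n : ℝ≥0) + 1) * t⌋₊)) ∈ U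
  rw [ha' _ (Finset.mem_range.2 (Nat.lt_succ_of_le (Nat.floor_le_floor (by gcongr))))]
  exact refl_mem_uniformity hU

/-- A random path in a countable discrete space, all of whose coordinates are measurable, has
measurable images for the Borel σ-algebra of the `J₁` topology. -/
theorem measurable_map_of_forall_measurable {Ω E F : Type*} [MeasurableSpace Ω]
    [TopologicalSpace E] [DiscreteTopology E] [Countable E] [MeasurableSpace E] [BorelSpace E]
    [UniformSpace F] [(𝓤 F).IsCountablyGenerated] (g : E → F) {Y : Ω → SkorokhodSpace E}
    (hY : ∀ t, Measurable fun ω => Y ω t) :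
    Measurable fun ω => (Y ω).map g continuous_of_discreteTopology := by
  refine measurable_of_tendsto_metrizable
    (f := fun n ω => stepPath n fun k => g (Y ω (k / ((n : ℝ≥0) + 1)))) (fun n => ?_)
    (tendsto_pi_nhds.2 fun ω => (Y ω).tendsto_stepPath g)
  exact (continuous_stepPath g n).measurable.comp (measurable_pi_lambda
    (fun ω (k : ℕ) => Y ω (k / ((n : ℝ≥0) + 1))) fun k => hY _)

/-! ### Martingale estimates -/

/-- A process with right-continuous paths is jointly measurable. -/
theorem measurable_uncurry_of_rightContinuous {Ω : Type*} [MeasurableSpace Ω] {Y : ℝ≥0 → Ω → ℝ}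
    (hm : ∀ t, Measurable (Y t))
    (hc : ∀ ω t, ContinuousWithinAt (fun s => Y s ω) (Set.Ici t) t) :
    Measurable fun p : ℝ≥0 × Ω => Y p.1 p.2 := by
  obtain ⟨φ, hφ⟩ : ∃ φ : ℕ → ℕ → ℝ≥0, ∀ n k, φ n k = ((k : ℝ≥0) + 1) / ((n : ℝ≥0) + 1) :=
    ⟨_, fun _ _ => rfl⟩
  refine measurable_of_tendsto_metrizable
    (f := fun (n : ℕ) p => Y (φ n ⌊((n : ℝ≥0) + 1) * p.1⌋₊) p.2)
    (fun n => ?_) (tendsto_pi_nhds.2 fun p => ?_)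
  · have h1 : Measurable fun q : ℕ × Ω => Y (φ n q.1) q.2 :=
      measurable_from_prod_countable_right fun k => hm (φ n k)
    have h2 : Measurable fun p : ℝ≥0 × Ω => (⌊((n : ℝ≥0) + 1) * p.1⌋₊, p.2) :=
      Measurable.prodMk (Nat.measurable_floor.comp (measurable_fst.const_mul ((n : ℝ≥0) + 1)))
        measurable_snd
    exact h1.comp h2
  · obtain ⟨t, ω⟩ := p
    refine Tendsto.comp (hc ω t) (tendsto_nhdsWithin_iff.2 ⟨?_, Eventually.of_forall fun n => ?_⟩)
    · have h0 : Tendsto (fun n : ℕ => t + 1 / ((n : ℝ≥0) + 1)) atTop (𝓝 (t + 0)) :=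
        tendsto_const_nhds.add tendsto_one_div_add_atTop_nhds_zero_nat
      rw [add_zero] at h0
      refine tendsto_of_tendsto_of_tendsto_of_le_of_le tendsto_const_nhds h0 (fun n => ?_)
        fun n => ?_
      · have hn : (0 : ℝ≥0) < (n : ℝ≥0) + 1 := by positivity
        rw [hφ, le_div_iff₀' hn]
        exact (Nat.lt_floor_add_one _).le
      · have hn : (0 : ℝ≥0) < (n : ℝ≥0) + 1 := by positivity
        rw [hφ, add_div]
        refine add_le_add_left ((div_le_iff₀' hn).2 ?_) _
        exact Nat.floor_le zero_le
    · have hn : (0 : ℝ≥0) < (n : ℝ≥0) + 1 := by positivity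
      change t ≤ _
      rw [hφ, le_div_iff₀' hn]
      exact (Nat.lt_floor_add_one _).le

theorem continuousWithinAt_comp_toNNReal {g : ℝ≥0 → ℝ}
    (hg : ∀ t, ContinuousWithinAt g (Set.Ici t) t) (t : ℝ) :
    ContinuousWithinAt (fun s : ℝ => g s.toNNReal) (Set.Ici t) t :=
  ContinuousWithinAt.comp (t := Set.Ici t.toNNReal) (hg _)
    continuous_real_toNNReal.continuousWithinAt fun _ hs => Real.toNNReal_le_toNNReal hs

/-- The integral of a bounded right-continuous function has that function as right derivative. -/
theorem hasDerivWithinAt_integral_of_rightContinuous {a : ℝ → ℝ} (hm : Measurable a) {C : ℝ}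
    (hb : ∀ s, |a s| ≤ C) {t : ℝ} (hc : ContinuousWithinAt a (Set.Ici t) t) :
    HasDerivWithinAt (fun u => ∫ s in (0 : ℝ)..u, a s) (a t) (Set.Ici t) t := by
  refine intervalIntegral.integral_hasDerivWithinAt_right ?_
    (t := Set.Ioi t) hm.stronglyMeasurable.stronglyMeasurableAtFilter
    (hc.mono Set.Ioi_subset_Ici_self)
  exact (intervalIntegrable_const (c := C)).mono_fun hm.aestronglyMeasurable
    (Eventually.of_forall fun s => (hb s).trans (le_abs_self C))

theorem intervalIntegrable_of_abs_le {a : ℝ → ℝ} (hm : Measurable a) {C : ℝ}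
    (hb : ∀ s, |a s| ≤ C) (t u : ℝ) : IntervalIntegrable a volume t u :=
  (intervalIntegrable_const (c := C)).mono_fun hm.aestronglyMeasurable
    (Eventually.of_forall fun s => (hb s).trans (le_abs_self C))

theorem sq_integral_eq_of_rightContinuous {a : ℝ → ℝ} (hm : Measurable a) {C : ℝ}
    (hb : ∀ s, |a s| ≤ C) (hc : ∀ t, 0 < t → ContinuousWithinAt a (Set.Ici t) t) {T : ℝ}
    (hT : 0 ≤ T) :
    (∫ s in (0 : ℝ)..T, a s) ^ 2 = 2 * ∫ s in (0 : ℝ)..T, (∫ u in (0 : ℝ)..s, a u) * a s := by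
  have hcont : Continuous fun t => ∫ s in (0 : ℝ)..t, a s :=
    intervalIntegral.continuous_primitive (fun _ _ => intervalIntegrable_of_abs_le hm hb _ _) 0
  have h := intervalIntegral.integral_eq_sub_of_hasDeriv_right_of_le (a := 0) (b := T)
    (f := fun t => (∫ s in (0 : ℝ)..t, a s) ^ 2)
    (f' := fun t => 2 * ((∫ s in (0 : ℝ)..t, a s) * a t)) hT (hcont.pow 2).continuousOn
    (fun t ht => by
      have := ((hasDerivWithinAt_integral_of_rightContinuous hm hb (hc t ht.1)).mono
        Set.Ioi_subset_Ici_self).pow 2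
      refine this.congr_deriv ?_
      simp
      ring)
    (((intervalIntegrable_of_abs_le hm hb 0 T).continuousOn_mul hcont.continuousOn).const_mul 2)
  rw [intervalIntegral.integral_const_mul] at h
  simp only [intervalIntegral.integral_same] at h
  linarith

/-- A bounded jointly measurable process is integrable on a bounded time interval. -/
theorem integrable_prod_of_abs_le {Ω : Type*} [MeasurableSpace Ω] {P : Measure Ω}
    [IsProbabilityMeasure P] {T C : ℝ} {h : ℝ≥0 → Ω → ℝ}
    (hm : Measurable fun p : ℝ≥0 × Ω => h p.1 p.2) (hb : ∀ t : ℝ≥0, (t : ℝ) ≤ T → ∀ ω, |h t ω| ≤ C) :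
    Integrable (fun p : ℝ × Ω => h p.1.toNNReal p.2)
      ((volume.restrict (Set.Ioc 0 T)).prod P) := by
  refine Integrable.of_bound (C := C) ?_ ?_
  · exact (hm.comp ((measurable_real_toNNReal.comp measurable_fst).prodMk
      measurable_snd)).aestronglyMeasurable
  · have h1 : ∀ᵐ s ∂(volume.restrict (Set.Ioc (0 : ℝ) T)), s ∈ Set.Ioc 0 T :=
      ae_restrict_mem measurableSet_Ioc
    have h2 := (Measure.quasiMeasurePreserving_fst (ν := P)).ae h1
    filter_upwards [h2] with p hp
    exact hb _ (by rw [Real.coe_toNNReal _ hp.1.le]; exact hp.2) _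

/-- If `f` and `f²` have compensators with densities `a` and `a₂`, then the square of the martingale
`f - f₀ - ∫ a` is compensated by the integral of `a₂ - 2 f a`, so that its mean at time `T` is at
most `K T` if `a₂ - 2 f a ≤ K`. -/
theorem integral_sq_compensated_le {Ω : Type*} {mΩ : MeasurableSpace Ω} {P : Measure Ω}
    [IsProbabilityMeasure P] {ℱ : Filtration ℝ≥0 mΩ} {f a a₂ : ℝ≥0 → Ω → ℝ} {C K : ℝ}
    (hfm : ∀ t, Measurable[ℱ t] (f t)) (ham : ∀ t, Measurable[ℱ t] (a t))
    (ha₂m : ∀ t, Measurable[ℱ t] (a₂ t))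
    (hfc : ∀ ω t, ContinuousWithinAt (fun s => f s ω) (Set.Ici t) t)
    (hac : ∀ ω t, ContinuousWithinAt (fun s => a s ω) (Set.Ici t) t)
    (ha₂c : ∀ ω t, ContinuousWithinAt (fun s => a₂ s ω) (Set.Ici t) t)
    (hfb : ∀ t ω, |f t ω| ≤ C) (hab : ∀ t ω, |a t ω| ≤ C) (ha₂b : ∀ t ω, |a₂ t ω| ≤ C)
    (hK : ∀ t ω, a₂ t ω - 2 * f t ω * a t ω ≤ K)
    (hM : Martingale (fun (t : ℝ≥0) ω => f t ω - ∫ s in (0 : ℝ)..t, a s.toNNReal ω) ℱ P)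
    (hM₂ : Martingale (fun (t : ℝ≥0) ω => f t ω ^ 2 - ∫ s in (0 : ℝ)..t, a₂ s.toNNReal ω) ℱ P)
    (T : ℝ≥0) :
    ∫ ω, (f T ω - f 0 ω - ∫ s in (0 : ℝ)..T, a s.toNNReal ω) ^ 2 ∂P ≤ K * T := by
  have hC : 0 ≤ C := by
    obtain ⟨ω⟩ : Nonempty Ω := nonempty_of_isProbabilityMeasure P
    exact (abs_nonneg _).trans (hfb 0 ω)
  let A : ℝ≥0 → Ω → ℝ := fun t ω => ∫ s in (0 : ℝ)..t, a s.toNNReal ω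
  let Z : ℝ≥0 → Ω → ℝ := fun t ω => f t ω - A t ω
  have hZM : Martingale Z ℱ P := hM
  have hfm' : ∀ t, Measurable (f t) := fun t => (hfm t).mono (ℱ.le t) le_rfl
  have ham' : ∀ t, Measurable (a t) := fun t => (ham t).mono (ℱ.le t) le_rfl
  have ha₂m' : ∀ t, Measurable (a₂ t) := fun t => (ha₂m t).mono (ℱ.le t) le_rfl
  have hZm : ∀ t, Measurable (Z t) := fun t =>
    ((hZM.stronglyMeasurable t).mono (ℱ.le t)).measurable
  have hAm : ∀ t, Measurable (A t) := fun t => by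
    have : A t = fun ω => f t ω - Z t ω := by ext ω; simp [Z]
    rw [this]
    exact (hfm' t).sub (hZm t)
  have hfJ := measurable_uncurry_of_rightContinuous hfm' hfc
  have haJ := measurable_uncurry_of_rightContinuous ham' hac
  have ha₂J := measurable_uncurry_of_rightContinuous ha₂m' ha₂c
  have hpath : ∀ ω, Measurable fun s : ℝ => a s.toNNReal ω := fun ω =>
    haJ.comp (measurable_real_toNNReal.prodMk measurable_const)
  have hpath₂ : ∀ ω, Measurable fun s : ℝ => a₂ s.toNNReal ω := fun ω =>
    ha₂J.comp (measurable_real_toNNReal.prodMk measurable_const)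
  have hpathf : ∀ ω, Measurable fun s : ℝ => f s.toNNReal ω := fun ω =>
    hfJ.comp (measurable_real_toNNReal.prodMk measurable_const)
  have hAcont : ∀ ω, Continuous fun t : ℝ≥0 => A t ω := fun ω =>
    (intervalIntegral.continuous_primitive
      (fun _ _ => intervalIntegrable_of_abs_le (hpath ω) (fun s => hab _ ω) _ _) 0).comp
      NNReal.continuous_coe
  have hAJ := measurable_uncurry_of_rightContinuous hAm fun ω t => (hAcont ω).continuousWithinAt
  have hAb : ∀ t : ℝ≥0, (t : ℝ) ≤ T → ∀ ω, |A t ω| ≤ C * T := fun t ht ω => by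
    have := intervalIntegral.norm_integral_le_of_norm_le_const (a := (0 : ℝ)) (b := t)
      (f := fun s => a s.toNNReal ω) (C := C) fun s _ => hab _ ω
    rw [sub_zero, abs_of_nonneg (NNReal.coe_nonneg t)] at this
    exact this.trans (mul_le_mul_of_nonneg_left ht hC)
  have hZb : ∀ t : ℝ≥0, (t : ℝ) ≤ T → ∀ ω, |Z t ω| ≤ C + C * T := fun t ht ω =>
    (abs_sub _ _).trans (add_le_add (hfb t ω) (hAb t ht ω))
  have hZJ : Measurable fun p : ℝ≥0 × Ω => Z p.1 p.2 := hfJ.sub hAJ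
  have intOf : ∀ {g : Ω → ℝ} {B : ℝ}, Measurable g → (∀ ω, |g ω| ≤ B) → Integrable g P :=
    fun hg hB => Integrable.of_bound hg.aestronglyMeasurable _ (Eventually.of_forall hB)
  have mulb : ∀ {x y B D : ℝ}, |x| ≤ B → |y| ≤ D → |x * y| ≤ B * D := fun hx hy => by
    rw [abs_mul]
    exact mul_le_mul hx hy (abs_nonneg _) ((abs_nonneg _).trans hx)
  -- the martingale property, tested against the past
  have hZtest : ∀ (s : ℝ≥0) (g : Ω → ℝ) (B : ℝ), s ≤ T → Measurable[ℱ s] g → (∀ ω, |g ω| ≤ B) →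
      ∫ ω, g ω * Z T ω ∂P = ∫ ω, g ω * Z s ω ∂P := fun s g B hs hg hB => by
    have hgm := hg.mono (ℱ.le s) le_rfl
    have h1 : Integrable (g * Z T) P :=
      intOf (hgm.mul (hZm T)) fun ω => mulb (hB ω) (hZb T le_rfl ω)
    have h2 := condExp_mul_of_stronglyMeasurable_left (m := ℱ s) (μ := P)
      hg.stronglyMeasurable h1 (hZM.integrable T)
    have h3 : P[g * Z T | ℱ s] =ᵐ[P] g * Z s := by
      refine h2.trans ?_
      filter_upwards [hZM.condExp_ae_eq hs] with ω hω
      simp [hω]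
    calc ∫ ω, g ω * Z T ω ∂P = ∫ ω, (P[g * Z T | ℱ s]) ω ∂P := (integral_condExp (ℱ.le s)).symm
      _ = ∫ ω, g ω * Z s ω ∂P := integral_congr_ae h3
  have hIoc : ∀ g : ℝ → ℝ, ∫ s in (0 : ℝ)..T, g s = ∫ s in Set.Ioc (0 : ℝ) T, g s := fun g =>
    intervalIntegral.integral_of_le T.2
  have hZA : ∫ ω, Z T ω * A T ω ∂P =
      ∫ ω, (∫ s in (0 : ℝ)..T, Z s.toNNReal ω * a s.toNNReal ω) ∂P := by
    have h1 := integrable_prod_of_abs_le (P := P) (T := T) (h := fun t ω => Z T ω * a t ω)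
      (C := (C + C * T) * C) (((hZm T).comp measurable_snd).mul haJ)
      fun t _ ω => mulb (hZb T le_rfl ω) (hab t ω)
    have h2 := integrable_prod_of_abs_le (P := P) (T := T) (h := fun t ω => Z t ω * a t ω)
      (C := (C + C * T) * C) (hZJ.mul haJ) fun t ht ω => mulb (hZb t ht ω) (hab t ω)
    calc ∫ ω, Z T ω * A T ω ∂P
        = ∫ ω, (∫ s in Set.Ioc (0 : ℝ) T, Z T ω * a s.toNNReal ω) ∂P := by
          refine integral_congr_ae (Eventually.of_forall fun ω => ?_)
          change _ = ∫ s in Set.Ioc (0 : ℝ) T, Z T ω * a s.toNNReal ω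
          rw [← hIoc, intervalIntegral.integral_const_mul]
      _ = ∫ s in Set.Ioc (0 : ℝ) T, ∫ ω, Z T ω * a s.toNNReal ω ∂P :=
          (integral_integral_swap h1).symm
      _ = ∫ s in Set.Ioc (0 : ℝ) T, ∫ ω, Z s.toNNReal ω * a s.toNNReal ω ∂P := by
          refine setIntegral_congr_fun measurableSet_Ioc fun s hs => ?_
          have := hZtest s.toNNReal (a s.toNNReal) C (Real.toNNReal_le_iff_le_coe.2 hs.2)
            (ham _) (hab _)
          simpa only [mul_comm] using this
      _ = ∫ ω, (∫ s in Set.Ioc (0 : ℝ) T, Z s.toNNReal ω * a s.toNNReal ω) ∂P :=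
          integral_integral_swap h2
      _ = _ := by simp only [hIoc]
  have hA0 : ∀ ω, A 0 ω = 0 := fun ω => by simp [A]
  have hZ0 : ∀ ω, Z 0 ω = f 0 ω := fun ω => by simp [Z, hA0]
  have hZ0T : ∫ ω, f 0 ω * Z T ω ∂P = ∫ ω, f 0 ω * f 0 ω ∂P := by
    rw [hZtest 0 (f 0) C zero_le (hfm 0) (hfb 0)]
    simp only [hZ0]
  have hiT2 : Integrable (fun ω => f T ω ^ 2) P :=
    intOf ((hfm' T).pow_const 2) (B := C * C) fun ω => by
      rw [sq]; exact mulb (hfb T ω) (hfb T ω)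
  have hi2 : Integrable (fun ω => ∫ s in (0 : ℝ)..T, a₂ s.toNNReal ω) P := by
    have := hiT2.sub (hM₂.integrable T)
    refine this.congr (Eventually.of_forall fun ω => ?_)
    simp
  have hf2 : ∫ ω, f T ω ^ 2 ∂P = ∫ ω, f 0 ω ^ 2 ∂P +
      ∫ ω, (∫ s in (0 : ℝ)..T, a₂ s.toNNReal ω) ∂P := by
    have h1 := hM₂.setIntegral_eq (zero_le : 0 ≤ T) MeasurableSet.univ
    simp only [setIntegral_univ, NNReal.coe_zero, intervalIntegral.integral_same, sub_zero] at h1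
    rw [h1, integral_sub hiT2 hi2]
    ring
  have hiZa : Integrable (fun ω => ∫ s in (0 : ℝ)..T, Z s.toNNReal ω * a s.toNNReal ω) P := by
    have h2 := integrable_prod_of_abs_le (P := P) (T := T) (h := fun t ω => Z t ω * a t ω)
      (C := (C + C * T) * C) (hZJ.mul haJ) fun t ht ω => mulb (hZb t ht ω) (hab t ω)
    simpa only [hIoc] using h2.integral_prod_right
  have hiZA : Integrable (fun ω => Z T ω * A T ω) P :=
    intOf ((hZm T).mul (hAm T)) fun ω => mulb (hZb T le_rfl ω) (hAb T le_rfl ω)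
  have hi0Z : Integrable (fun ω => f 0 ω * Z T ω) P :=
    intOf ((hfm' 0).mul (hZm T)) fun ω => mulb (hfb 0 ω) (hZb T le_rfl ω)
  have hi00 : Integrable (fun ω => f 0 ω * f 0 ω) P :=
    intOf ((hfm' 0).mul (hfm' 0)) fun ω => mulb (hfb 0 ω) (hfb 0 ω)
  have hiA2 : Integrable (fun ω => A T ω ^ 2) P :=
    intOf ((hAm T).pow_const 2) (B := C * T * (C * T)) fun ω => by
      rw [sq]; exact mulb (hAb T le_rfl ω) (hAb T le_rfl ω)
  -- the pathwise computation of the integrand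
  have hpt : ∀ ω, 2 * (∫ s in (0 : ℝ)..T, Z s.toNNReal ω * a s.toNNReal ω) + A T ω ^ 2 =
      ∫ s in (0 : ℝ)..T, 2 * f s.toNNReal ω * a s.toNNReal ω := fun ω => by
    have h1 := sq_integral_eq_of_rightContinuous (hpath ω) (fun s => hab _ ω)
      (fun t _ => continuousWithinAt_comp_toNNReal (hac ω) t)      (NNReal.coe_nonneg T)
    have h2 : ∫ s in (0 : ℝ)..T, (∫ u in (0 : ℝ)..s, a u.toNNReal ω) * a s.toNNReal ω =
        ∫ s in (0 : ℝ)..T, A s.toNNReal ω * a s.toNNReal ω := by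
      refine intervalIntegral.integral_congr fun s hs => ?_
      rw [Set.uIcc_of_le (NNReal.coe_nonneg T)] at hs
      simp only [A, Real.coe_toNNReal _ hs.1]
    have hai := intervalIntegrable_of_abs_le (hpath ω) (fun s => hab _ ω) 0 T
    have hAi : IntervalIntegrable (fun s : ℝ => A s.toNNReal ω * a s.toNNReal ω) volume 0 T :=
      hai.continuousOn_mul ((hAcont ω).comp continuous_real_toNNReal).continuousOn
    have hfi : IntervalIntegrable (fun s : ℝ => f s.toNNReal ω * a s.toNNReal ω) volume 0 T :=
      intervalIntegrable_of_abs_le ((hpathf ω).mul (hpath ω))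
        (fun s => mulb (hfb _ ω) (hab _ ω)) 0 T
    have h3 : ∫ s in (0 : ℝ)..T, Z s.toNNReal ω * a s.toNNReal ω =
        (∫ s in (0 : ℝ)..T, f s.toNNReal ω * a s.toNNReal ω) -
          ∫ s in (0 : ℝ)..T, A s.toNNReal ω * a s.toNNReal ω := by
      rw [← intervalIntegral.integral_sub hfi hAi]
      simp only [Z, sub_mul]
    have h4 : A T ω ^ 2 = 2 * ∫ s in (0 : ℝ)..T, A s.toNNReal ω * a s.toNNReal ω := by
      rw [← h2]; exact h1
    simp only [mul_assoc]
    rw [h3, h4, intervalIntegral.integral_const_mul]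
    ring
  have hle : ∀ ω, (∫ s in (0 : ℝ)..T, a₂ s.toNNReal ω) -
      2 * (∫ s in (0 : ℝ)..T, Z s.toNNReal ω * a s.toNNReal ω) - A T ω ^ 2 ≤ K * T := fun ω => by
    have hfi : IntervalIntegrable (fun s : ℝ => 2 * f s.toNNReal ω * a s.toNNReal ω) volume 0 T :=
      intervalIntegrable_of_abs_le (((hpathf ω).const_mul 2).mul (hpath ω)) (C := 2 * C * C)
        (fun s => mulb (by rw [abs_mul, abs_two]; linarith [hfb s.toNNReal ω]) (hab _ ω)) 0 T
    have h2i := intervalIntegrable_of_abs_le (hpath₂ ω) (fun s => ha₂b _ ω) 0 T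
    rw [sub_sub, hpt, ← intervalIntegral.integral_sub h2i hfi]
    calc _ ≤ ∫ _ in (0 : ℝ)..T, K :=
          intervalIntegral.integral_mono_on T.2 (h2i.sub hfi) intervalIntegrable_const
            fun s _ => hK _ ω
      _ = K * T := by simp [mul_comm]
  have hexp : ∀ ω, (f T ω - f 0 ω - A T ω) ^ 2 = f T ω ^ 2 - 2 * (Z T ω * A T ω) - A T ω ^ 2 -
      2 * (f 0 ω * Z T ω) + f 0 ω * f 0 ω := fun ω => by
    simp only [Z]; ring
  have i1 : Integrable (fun ω => f T ω ^ 2 - 2 * (Z T ω * A T ω)) P := hiT2.sub (hiZA.const_mul 2)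
  have i2 : Integrable (fun ω => f T ω ^ 2 - 2 * (Z T ω * A T ω) - A T ω ^ 2) P := i1.sub hiA2
  have i3 : Integrable (fun ω => f T ω ^ 2 - 2 * (Z T ω * A T ω) - A T ω ^ 2 -
      2 * (f 0 ω * Z T ω)) P := i2.sub (hi0Z.const_mul 2)
  have j1 : Integrable (fun ω => (∫ s in (0 : ℝ)..T, a₂ s.toNNReal ω) -
      2 * (∫ s in (0 : ℝ)..T, Z s.toNNReal ω * a s.toNNReal ω)) P := hi2.sub (hiZa.const_mul 2)
  calc ∫ ω, (f T ω - f 0 ω - ∫ s in (0 : ℝ)..T, a s.toNNReal ω) ^ 2 ∂P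
      = ∫ ω, (f T ω ^ 2 - 2 * (Z T ω * A T ω) - A T ω ^ 2 -
          2 * (f 0 ω * Z T ω) + f 0 ω * f 0 ω) ∂P :=
        integral_congr_ae (Eventually.of_forall hexp)
    _ = ∫ ω, f T ω ^ 2 ∂P - 2 * ∫ ω, Z T ω * A T ω ∂P - ∫ ω, A T ω ^ 2 ∂P -
          2 * ∫ ω, f 0 ω * Z T ω ∂P + ∫ ω, f 0 ω * f 0 ω ∂P := by
        rw [integral_add i3 hi00, integral_sub i2 (hi0Z.const_mul 2), integral_sub i1 hiA2,
          integral_sub hiT2 (hiZA.const_mul 2), integral_const_mul, integral_const_mul]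
    _ = ∫ ω, ((∫ s in (0 : ℝ)..T, a₂ s.toNNReal ω) -
          2 * (∫ s in (0 : ℝ)..T, Z s.toNNReal ω * a s.toNNReal ω) - A T ω ^ 2) ∂P := by
        rw [integral_sub j1 hiA2, integral_sub hi2 (hiZa.const_mul 2),
          integral_const_mul, hf2, hZA, hZ0T]
        simp only [sq]
        ring
    _ ≤ ∫ _, K * T ∂P :=
        integral_mono (j1.sub hiA2) (integrable_const _) hle
    _ = K * T := by simp

/-- Doob's maximal inequality for a right-continuous martingale on a bounded time interval. -/
theorem measure_exists_lt_abs_le {Ω : Type*} {mΩ : MeasurableSpace Ω} {P : Measure Ω}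
    [IsProbabilityMeasure P] {ℱ : Filtration ℝ≥0 mΩ} {M : ℝ≥0 → Ω → ℝ} (hM : Martingale M ℱ P)
    (hc : ∀ ω t, ContinuousWithinAt (fun s => M s ω) (Set.Ici t) t) (T : ℝ≥0) {η : ℝ}
    (hη : 0 < η) :
    P {ω | ∃ t ≤ T, η < |M t ω|} ≤ ENNReal.ofReal ((∫ ω, |M T ω| ∂P) / η) := by
  lift η to ℝ≥0 using hη.le
  let S : ℕ → Set Ω := fun n => {ω | ∃ k : ℕ, k ≤ 2 ^ n ∧ η ≤ |M (k * (T / 2 ^ n)) ω|}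
  have hmono : Monotone S := monotone_nat_of_le_succ fun n ω ⟨k, hk, h⟩ => by
    refine ⟨2 * k, by rw [pow_succ]; lia, ?_⟩
    have : ((2 * k : ℕ) : ℝ≥0) * (T / 2 ^ (n + 1)) = k * (T / 2 ^ n) := by
      push_cast; rw [pow_succ]; field_simp
    rwa [this]
  have hsub : {ω | ∃ t ≤ T, η < |M t ω|} ⊆ ⋃ n, S n := by
    rintro ω ⟨t, ht, h⟩
    rcases ht.eq_or_lt with rfl | htT
    · exact Set.mem_iUnion.2 ⟨0, 1, by simp, by simpa using h.le⟩
    · have hT : 0 < T := zero_le.trans_lt htT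
      have h1 : ∀ᶠ s in 𝓝[≥] t, η < |M s ω| :=
        ((hc ω t).abs).eventually (eventually_gt_nhds h)
      -- the next point of the dyadic grid tends to `t` from the right
      have h2 : Tendsto (fun n : ℕ => (⌈t / (T / 2 ^ n)⌉₊ : ℝ≥0) * (T / 2 ^ n)) atTop
          (𝓝[≥] t) := by
        have hpos : ∀ n : ℕ, 0 < T / 2 ^ n := fun n => by positivity
        have hlow : ∀ n : ℕ, t ≤ (⌈t / (T / 2 ^ n)⌉₊ : ℝ≥0) * (T / 2 ^ n) := fun n =>
          (div_le_iff₀ (hpos n)).1 (Nat.le_ceil _)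
        refine tendsto_nhdsWithin_iff.2 ⟨?_, Eventually.of_forall hlow⟩
        have h0 : Tendsto (fun n : ℕ => t + T * (2⁻¹) ^ n) atTop (𝓝 (t + T * 0)) :=
          tendsto_const_nhds.add
            ((NNReal.tendsto_pow_atTop_nhds_zero_of_lt_one (by
              rw [← NNReal.coe_lt_coe]; norm_num)).const_mul T)
        rw [mul_zero, add_zero] at h0
        refine tendsto_of_tendsto_of_tendsto_of_le_of_le tendsto_const_nhds h0 hlow fun n => ?_
        calc (⌈t / (T / 2 ^ n)⌉₊ : ℝ≥0) * (T / 2 ^ n)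
            ≤ (t / (T / 2 ^ n) + 1) * (T / 2 ^ n) := by
              gcongr
              exact (Nat.ceil_lt_add_one zero_le).le
          _ = t + T * (2⁻¹) ^ n := by
              rw [add_mul, div_mul_cancel₀ _ (hpos n).ne', one_mul, inv_pow, div_eq_mul_inv]
      obtain ⟨n, hn⟩ := (h2.eventually h1).exists
      refine Set.mem_iUnion.2 ⟨n, _, ?_, hn.le⟩
      rw [Nat.ceil_le]
      push_cast
      rw [div_le_iff₀ (by positivity), mul_div_cancel₀ _ (by positivity)]
      exact ht
  have hbound : ∀ n, P (S n) ≤ ENNReal.ofReal ((∫ ω, |M T ω| ∂P) / η) := fun n => by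
    let τ : ℕ → ℝ≥0 := fun k => k * (T / 2 ^ n)
    have hτ : Monotone τ := fun i j hij => by
      have : (i : ℝ≥0) ≤ j := by exact_mod_cast hij
      simp only [τ]
      gcongr
    let 𝒢 : Filtration ℕ mΩ := ⟨fun k => ℱ (τ k), fun i j hij => ℱ.mono (hτ hij),
      fun k => ℱ.le _⟩
    have hMτ : Martingale (fun k => M (τ k)) 𝒢 P :=
      ⟨fun k => hM.stronglyMeasurable (τ k), fun i j hij => hM.condExp_ae_eq (hτ hij)⟩
    have hsm : Submartingale (fun k ω => |M (τ k) ω|) 𝒢 P :=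
      hMτ.submartingale.sup hMτ.neg.submartingale
    have h1 := maximal_ineq hsm (fun k ω => abs_nonneg _) (ε := η) (2 ^ n)
    have h2 : S n ⊆ {ω | (η : ℝ) ≤
        (Finset.range (2 ^ n + 1)).sup' Finset.nonempty_range_add_one
          fun k => |M (τ k) ω|} := by
      rintro ω ⟨k, hk, h⟩
      exact h.trans (Finset.le_sup' (fun k => |M (τ k) ω|) (Finset.mem_range.2 (by lia)))
    have hτT : τ (2 ^ n) = T := by
      simp only [τ]
      push_cast
      exact mul_div_cancel₀ _ (by positivity)
    have h3 : ENNReal.ofReal η * P (S n) ≤ ENNReal.ofReal (∫ ω, |M T ω| ∂P) := by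
      rw [hτT] at h1
      rw [ENNReal.ofReal_coe_nnreal]
      refine (mul_le_mul_right (measure_mono h2) _).trans (h1.trans ?_)
      refine ENNReal.ofReal_le_ofReal ?_
      exact setIntegral_le_integral (hM.integrable T).abs
        (Eventually.of_forall fun ω => abs_nonneg _)
    rw [ENNReal.ofReal_div_of_pos hη, ENNReal.le_div_iff_mul_le
      (Or.inl (ENNReal.ofReal_pos.2 hη).ne') (Or.inl ENNReal.ofReal_ne_top), mul_comm]
    exact h3
  calc P {ω | ∃ t ≤ T, η < |M t ω|} ≤ P (⋃ n, S n) := measure_mono hsub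
    _ = ⨆ n, P (S n) := hmono.measure_iUnion
    _ ≤ _ := iSup_le hbound

theorem integral_abs_le_sqrt_integral_sq {Ω : Type*} [MeasurableSpace Ω] {P : Measure Ω}
    [IsProbabilityMeasure P] {g : Ω → ℝ} (hg : Integrable g P)
    (hg2 : Integrable (fun ω => g ω ^ 2) P) : ∫ ω, |g ω| ∂P ≤ √(∫ ω, g ω ^ 2 ∂P) := by
  refine Real.le_sqrt_of_sq_le ?_
  set c := ∫ ω, |g ω| ∂P with hc
  have h1 : 0 ≤ ∫ ω, (|g ω| - c) ^ 2 ∂P := integral_nonneg fun ω => sq_nonneg _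
  have h2 : ∫ ω, (|g ω| - c) ^ 2 ∂P = ∫ ω, g ω ^ 2 ∂P - 2 * c * c + c ^ 2 := by
    have h3 : ∀ ω, (|g ω| - c) ^ 2 = g ω ^ 2 - 2 * c * |g ω| + c ^ 2 := fun ω => by
      rw [sub_sq, sq_abs]; ring
    simp only [h3]
    have h4 : Integrable (fun ω => g ω ^ 2 - 2 * c * |g ω|) P := hg2.sub (hg.abs.const_mul _)
    rw [integral_add h4 (integrable_const _),
      integral_sub hg2 (hg.abs.const_mul _), integral_const_mul, ← hc]
    simp
  nlinarith

/-! ### Sampling without replacement -/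

/-- The mean of `h S`, where `S` is a uniformly distributed set of `d` out of `N` servers. -/
def sampleMean (N d : ℕ) (h : Finset (Fin N) → ℝ) : ℝ :=
  (N.choose d : ℝ)⁻¹ * ∑ S ∈ Finset.powersetCard d Finset.univ, h S

theorem sampleMean_mono {N d : ℕ} {h h' : Finset (Fin N) → ℝ}
    (hh : ∀ S, S.card = d → h S ≤ h' S) : sampleMean N d h ≤ sampleMean N d h' := by
  refine mul_le_mul_of_nonneg_left (Finset.sum_le_sum fun S hS => ?_) (by positivity)
  exact hh S (Finset.mem_powersetCard.1 hS).2

theorem sampleMean_const {N d : ℕ} (hd : d ≤ N) (c : ℝ) : sampleMean N d (fun _ => c) = c := by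
  have : (N.choose d : ℝ) ≠ 0 := by exact_mod_cast (Nat.choose_pos hd).ne'
  simp [sampleMean, Finset.card_powersetCard, this]

theorem sampleMean_const_mul {N d : ℕ} (c : ℝ) (h : Finset (Fin N) → ℝ) :
    sampleMean N d (fun S => c * h S) = c * sampleMean N d h := by
  simp only [sampleMean, ← Finset.mul_sum]
  ring

theorem sampleMean_add {N d : ℕ} (h h' : Finset (Fin N) → ℝ) :
    sampleMean N d (fun S => h S + h' S) = sampleMean N d h + sampleMean N d h' := by
  simp only [sampleMean, Finset.sum_add_distrib, mul_add]

theorem sampleMean_sum {N d : ℕ} {ι : Type*} (s : Finset ι) (h : ι → Finset (Fin N) → ℝ) :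
    sampleMean N d (fun S => ∑ i ∈ s, h i S) = ∑ i ∈ s, sampleMean N d (h i) := by
  simp only [sampleMean, ← Finset.mul_sum]
  rw [Finset.sum_comm]

/-- The probability that a given server is sampled. -/
theorem sampleMean_mem {N d : ℕ} (hd : d ≤ N) (i : Fin N) :
    sampleMean N d (fun S => if i ∈ S then 1 else 0) = (d : ℝ) / N := by
  have hN : 0 < N := i.pos
  have hC : (N.choose d : ℝ) ≠ 0 := by exact_mod_cast (Nat.choose_pos hd).ne'
  rw [sampleMean, Finset.sum_boole]
  rcases Nat.eq_zero_or_pos d with rfl | hd0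
  · simp
  · have h1 := Finset.card_filter_powersetCard_subset {i} (Finset.univ : Finset (Fin N)) d
      (Finset.subset_univ _) (by rw [Finset.card_singleton]; exact hd0)
    simp only [Finset.singleton_subset_iff, Finset.card_univ, Fintype.card_fin,
      Finset.card_singleton] at h1
    rw [h1]
    have h2 := Nat.choose_mul (n := N) (k := d) (s := 1) hd0
    simp only [Nat.choose_one_right] at h2
    have h3 : (N.choose d : ℝ) * d = N * (N - 1).choose (d - 1) := by exact_mod_cast h2
    have hN' : (N : ℝ) ≠ 0 := by positivity
    field_simp
    linarith

/-- The events that two given servers are sampled are negatively correlated. -/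
theorem sampleMean_mem_and_mem_le {N d : ℕ} (hd : d ≤ N) {i j : Fin N} (hij : i ≠ j) :
    sampleMean N d (fun S => if i ∈ S ∧ j ∈ S then 1 else 0) ≤ ((d : ℝ) / N) ^ 2 := by
  have hN : 2 ≤ N := by
    have h1 := i.2
    have h2 := j.2
    have h3 : (i : ℕ) ≠ j := fun h => hij (Fin.ext h)
    lia
  have hC : (N.choose d : ℝ) ≠ 0 := by exact_mod_cast (Nat.choose_pos hd).ne'
  rw [sampleMean, Finset.sum_boole]
  have hpair : ∀ S : Finset (Fin N), (i ∈ S ∧ j ∈ S) ↔ {i, j} ⊆ S := fun S => by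
    simp [Finset.insert_subset_iff]
  simp only [hpair]
  rcases Nat.lt_or_ge d 2 with hd2 | hd2
  · have : (Finset.powersetCard d (Finset.univ : Finset (Fin N))).filter ({i, j} ⊆ ·) = ∅ := by
      refine Finset.filter_eq_empty_iff.2 fun S hS hsub => ?_
      have := Finset.card_le_card hsub
      rw [Finset.card_pair hij, (Finset.mem_powersetCard.1 hS).2] at this
      lia
    rw [this]
    simp only [Finset.card_empty, Nat.cast_zero, mul_zero]
    positivity
  · have h1 := Finset.card_filter_powersetCard_subset {i, j} (Finset.univ : Finset (Fin N)) d
      (Finset.subset_univ _) (by rwa [Finset.card_pair hij])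
    rw [Finset.card_pair hij, Finset.card_univ, Fintype.card_fin] at h1
    rw [h1]
    have h2 : (N.choose d : ℝ) * d.choose 2 = N.choose 2 * (N - 2).choose (d - 2) := by
      exact_mod_cast Nat.choose_mul (n := N) hd2
    rw [Nat.cast_choose_two, Nat.cast_choose_two] at h2
    have hN' : (2 : ℝ) ≤ N := by exact_mod_cast hN
    have hd' : (2 : ℝ) ≤ d := by exact_mod_cast hd2
    have hdN : (d : ℝ) ≤ N := by exact_mod_cast hd
    have h3 : (N.choose d : ℝ)⁻¹ * (N - 2).choose (d - 2) = d * (d - 1) / (N * (N - 1)) := by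
      have : (N : ℝ) - 1 ≠ 0 := by linarith
      have : (N : ℝ) ≠ 0 := by linarith
      field_simp
      linarith
    rw [h3, div_pow, div_le_div_iff₀ (by nlinarith) (by nlinarith)]
    have h4 : ((d : ℝ) - 1) * N ≤ d * (N - 1) := by nlinarith
    nlinarith [mul_le_mul_of_nonneg_left h4 (by positivity : (0 : ℝ) ≤ d * N)]

/-- The number of sampled servers in a set `I`, a hypergeometric random variable, has variance at
most its mean. -/
theorem sampleMean_sq_sub_le {N d : ℕ} (hN : 0 < N) (hd : d ≤ N) (I : Finset (Fin N)) :
    sampleMean N d (fun S => (((S ∩ I).card : ℝ) - d * I.card / N) ^ 2) ≤ d * I.card / N := by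
  set p : ℝ := d / N with hp
  set m : ℝ := (I.card : ℝ)
  have hp0 : 0 ≤ p := by positivity
  have hμ : (d : ℝ) * m / N = p * m := by rw [hp]; ring
  have hcard : ∀ S : Finset (Fin N), ((S ∩ I).card : ℝ) = ∑ i ∈ I, if i ∈ S then (1 : ℝ) else 0 :=
    fun S => by rw [Finset.sum_boole, Finset.inter_comm, ← Finset.filter_mem_eq_inter]
  have h1 : sampleMean N d (fun S => ((S ∩ I).card : ℝ)) = p * m := by
    simp only [hcard]
    rw [sampleMean_sum]
    simp only [sampleMean_mem hd]
    rw [Finset.sum_const, nsmul_eq_mul, mul_comm]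
  have h2 : sampleMean N d (fun S => ((S ∩ I).card : ℝ) ^ 2) ≤ p * m + (p * m) ^ 2 := by
    have hsq : ∀ S : Finset (Fin N), ((S ∩ I).card : ℝ) ^ 2 =
        ∑ i ∈ I, ∑ j ∈ I, if i ∈ S ∧ j ∈ S then (1 : ℝ) else 0 := fun S => by
      rw [hcard, sq, Finset.sum_mul_sum]
      simp only [ite_and, ite_mul, one_mul, zero_mul]
    simp only [hsq]
    rw [sampleMean_sum]
    calc ∑ i ∈ I, sampleMean N d (fun S => ∑ j ∈ I, if i ∈ S ∧ j ∈ S then (1 : ℝ) else 0)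
        ≤ ∑ i ∈ I, (p + m * p ^ 2) := by
          refine Finset.sum_le_sum fun i hi => ?_
          rw [sampleMean_sum, ← Finset.add_sum_erase _ _ hi]
          refine add_le_add ?_ ?_
          · simp only [and_self, sampleMean_mem hd]
            exact le_rfl
          · calc _ ≤ ∑ j ∈ I.erase i, p ^ 2 := Finset.sum_le_sum fun j hj =>
                  sampleMean_mem_and_mem_le hd (Finset.ne_of_mem_erase hj).symm
              _ = (I.erase i).card * p ^ 2 := by rw [Finset.sum_const, nsmul_eq_mul]
              _ ≤ m * p ^ 2 := by
                  have : ((I.erase i).card : ℝ) ≤ I.card := by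
                    exact_mod_cast Finset.card_le_card (Finset.erase_subset i I)
                  gcongr
      _ = p * m + (p * m) ^ 2 := by rw [Finset.sum_const, nsmul_eq_mul]; ring
  rw [hμ]
  have h3 : sampleMean N d (fun S => (((S ∩ I).card : ℝ) - p * m) ^ 2) =
      sampleMean N d (fun S => ((S ∩ I).card : ℝ) ^ 2) +
        ((-2 * (p * m)) * sampleMean N d (fun S => ((S ∩ I).card : ℝ)) + (p * m) ^ 2) := by
    rw [← sampleMean_const_mul, ← sampleMean_const (N := N) hd ((p * m) ^ 2), ← sampleMean_add,
      ← sampleMean_add]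
    congr 1
    ext S
    ring
  rw [h3, h1]
  nlinarith

/-- If the mean number of sampled servers in `I` exceeds `ℓ` by a factor `1 + c`, then the mean
shortage below `ℓ` is bounded, whatever the size of `ℓ`. This is Chebyshev's inequality, in the form
`(ℓ - k)⁺ ≤ (k - μ)² / (4 (μ - ℓ))` for `ℓ < μ`. -/
theorem sampleMean_shortage_le {N d ℓ : ℕ} (hN : 0 < N) (hd : d ≤ N) (hℓ : 0 < ℓ)
    (I : Finset (Fin N)) {c : ℝ} (hc : 0 < c) (h : (1 + c) * ℓ ≤ d * I.card / N) :
    sampleMean N d (fun S => max 0 ((ℓ : ℝ) - (S ∩ I).card)) ≤ (1 + c) / (4 * c) := by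
  set μ : ℝ := d * I.card / N with hμ
  have hℓ' : (0 : ℝ) < ℓ := by exact_mod_cast hℓ
  have hμℓ : 0 < μ - ℓ := by nlinarith
  calc sampleMean N d (fun S => max 0 ((ℓ : ℝ) - (S ∩ I).card))
      ≤ sampleMean N d (fun S => (4 * (μ - ℓ))⁻¹ * (((S ∩ I).card : ℝ) - μ) ^ 2) := by
        refine sampleMean_mono fun S _ => max_le (by positivity) ?_
        rw [inv_mul_eq_div, le_div_iff₀ (by positivity)]
        nlinarith [sq_nonneg (((S ∩ I).card : ℝ) - μ + 2 * (μ - ℓ))]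
    _ = (4 * (μ - ℓ))⁻¹ * sampleMean N d (fun S => (((S ∩ I).card : ℝ) - μ) ^ 2) :=
        sampleMean_const_mul _ _
    _ ≤ (4 * (μ - ℓ))⁻¹ * μ := by
        gcongr
        exact sampleMean_sq_sub_le hN hd I
    _ ≤ (1 + c) / (4 * c) := by
        rw [inv_mul_eq_div, div_le_div_iff₀ (by positivity) (by positivity)]
        nlinarith

/-! ### The generator on averages over the servers -/

/-- The average of `g` over the queue lengths of the `N` servers; it is `0` for `N = 0`. -/
def queueMean {N : ℕ} (g : ℕ → ℝ) (x : Fin N → ℕ) : ℝ := (∑ j, g (x j)) / N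

/-- The indicator of a busy server, whose average over the servers is `q₁`. -/
def busy (n : ℕ) : ℝ := (min n 1 : ℕ)

/-- The number of tasks that wait behind the first one in a queue of length `n`, truncated at `K` so
that it is bounded; its average over the servers is `q₂ + ⋯ + q_{K+1}`. -/
def waiting (K n : ℕ) : ℝ := (min (n - 1) K : ℕ)

theorem fluidOccupancy_eq_queueMean {N : ℕ} (x : Fin N → ℕ) (i : ℕ) :
    fluidOccupancy x i = queueMean (fun n => if i ≤ n then 1 else 0) x := by
  rw [fluidOccupancy, occupancy, queueMean, Finset.sum_boole]

theorem fluidOccupancy_one {N : ℕ} (x : Fin N → ℕ) : fluidOccupancy x 1 = queueMean busy x := by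
  rw [fluidOccupancy_eq_queueMean]
  congr 1
  ext n
  rcases n with _ | n <;> simp [busy]

theorem queueMean_waiting {N : ℕ} (K : ℕ) (x : Fin N → ℕ) :
    queueMean (waiting K) x = ∑ k ∈ Finset.range K, fluidOccupancy x (k + 2) := by
  simp only [fluidOccupancy_eq_queueMean, queueMean]
  rw [← Finset.sum_div, Finset.sum_comm]
  congr 1
  refine Finset.sum_congr rfl fun j _ => ?_
  rw [Finset.sum_boole, waiting]
  have : (Finset.range K).filter (fun k => k + 2 ≤ x j) = Finset.range (min (x j - 1) K) := by
    ext k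
    simp only [Finset.mem_filter, Finset.mem_range]
    lia
  rw [this, Finset.card_range]

theorem queueMean_waiting_one {N : ℕ} (x : Fin N → ℕ) :
    queueMean (waiting 1) x = fluidOccupancy x 2 := by
  rw [queueMean_waiting, Finset.sum_range_one]

theorem queueMean_sub {N : ℕ} (g : ℕ → ℝ) (x y : Fin N → ℕ) :
    queueMean g y - queueMean g x = (∑ j, (g (y j) - g (x j))) / N := by
  rw [queueMean, queueMean, Finset.sum_sub_distrib, sub_div]

theorem queueMean_removeTask_sub {N : ℕ} (g : ℕ → ℝ) (x : Fin N → ℕ) (j : Fin N) :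
    queueMean g (removeTask x j) - queueMean g x = (g (x j - 1) - g (x j)) / N := by
  rw [queueMean_sub]
  congr 1
  rw [Finset.sum_eq_single_of_mem j (Finset.mem_univ j)]
  · simp [removeTask]
  · intro i _ hij
    simp [removeTask, hij]

theorem queueMean_addBatch_sub {N : ℕ} (g : ℕ → ℝ) (b : ℕ∞) (x : Fin N → ℕ)
    (B : Finset (Fin N)) :
    queueMean g (addBatch b x B) - queueMean g x =
      (∑ j ∈ B, (g (addBatch b x B j) - g (x j))) / N := by
  rw [queueMean_sub]
  congr 1
  refine (Finset.sum_subset (Finset.subset_univ B) fun j _ hj => ?_).symm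
  simp [addBatch, hj]

/-- A function of the queue length that does not decrease, and increases by at most one, per
task. -/
def IsTaskCount (g : ℕ → ℝ) : Prop := ∀ n, g n ≤ g (n + 1) ∧ g (n + 1) ≤ g n + 1

theorem isTaskCount_busy : IsTaskCount busy := fun n => by
  rcases n with _ | n <;> simp [busy]

theorem isTaskCount_waiting (K : ℕ) : IsTaskCount (waiting K) := fun n => by
  constructor
  · simp only [waiting]
    exact_mod_cast (by lia : min (n - 1) K ≤ min (n + 1 - 1) K)
  · simp only [waiting]
    exact_mod_cast (by lia : min (n + 1 - 1) K ≤ min (n - 1) K + 1)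

theorem IsTaskCount.pred {g : ℕ → ℝ} (hg : IsTaskCount g) (n : ℕ) :
    g (n - 1) ≤ g n ∧ g n ≤ g (n - 1) + 1 := by
  rcases n with _ | n
  · simp
  · exact hg n

theorem IsTaskCount.addBatch {N : ℕ} {g : ℕ → ℝ} (hg : IsTaskCount g) (b : ℕ∞) (x : Fin N → ℕ)
    (B : Finset (Fin N)) (j : Fin N) :
    0 ≤ g (addBatch b x B j) - g (x j) ∧ g (BatchJSQ.addBatch b x B j) - g (x j) ≤ 1 := by
  unfold BatchJSQ.addBatch
  split_ifs
  · have := hg (x j)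
    constructor <;> linarith
  · simp

/-- The mean of `h B`, where `B` is the set of servers that receive the tasks of a batch arriving in
state `x`. -/
def batchMean {N : ℕ} (d : ℕ) (sel : (Fin N → ℕ) → Finset (Fin N) → PMF (Finset (Fin N)))
    (x : Fin N → ℕ) (h : Finset (Fin N) → ℝ) : ℝ :=
  sampleMean N d fun S => ∑ B : Finset (Fin N), (sel x S B).toReal * h B

theorem batchGenerator_eq {N : ℕ} (ℓ d : ℕ) (b : ℕ∞) (rate : ℝ)
    (sel : (Fin N → ℕ) → Finset (Fin N) → PMF (Finset (Fin N)))
    (f : (Fin N → ℕ) → ℝ) (x : Fin N → ℕ) :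
    batchGenerator ℓ d b rate sel f x = (∑ j with 0 < x j, (f (removeTask x j) - f x)) +
      rate / ℓ * batchMean d sel x fun B => f (addBatch b x B) - f x := rfl

section Batch

variable {N ℓ d : ℕ} {sel : (Fin N → ℕ) → Finset (Fin N) → PMF (Finset (Fin N))}

theorem sum_sel_toReal (x : Fin N → ℕ) (S : Finset (Fin N)) :
    ∑ B : Finset (Fin N), (sel x S B).toReal = 1 := by
  have h := (sel x S).tsum_coe
  rw [tsum_fintype] at h
  rw [← ENNReal.toReal_sum fun B _ => (sel x S).apply_ne_top B, h, ENNReal.toReal_one]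

theorem batchMean_const_mul (x : Fin N → ℕ) (c : ℝ) (h : Finset (Fin N) → ℝ) :
    batchMean d sel x (fun B => c * h B) = c * batchMean d sel x h := by
  simp only [batchMean, ← sampleMean_const_mul, Finset.mul_sum]
  congr 1
  ext S
  exact Finset.sum_congr rfl fun B _ => by ring

theorem batchMean_sub (x : Fin N → ℕ) (h h' : Finset (Fin N) → ℝ) :
    batchMean d sel x (fun B => h B - h' B) = batchMean d sel x h - batchMean d sel x h' := by
  have := batchMean_const_mul (d := d) (sel := sel) x (-1) h'
  rw [sub_eq_add_neg, ← neg_one_mul, ← this, batchMean, batchMean, batchMean, ← sampleMean_add]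
  congr 1
  ext S
  rw [← Finset.sum_add_distrib]
  exact Finset.sum_congr rfl fun B _ => by ring

/-- Bounds that hold for all selections of shortest queues carry over to the mean. -/
theorem batchMean_le_sampleMean
    (hsel : ∀ x S, S.card = d → ∀ B ∈ (sel x S).support, IsShortestSelection ℓ x S B)
    (x : Fin N → ℕ) {h k : Finset (Fin N) → ℝ}
    (hk : ∀ S B, IsShortestSelection ℓ x S B → h B ≤ k S) :
    batchMean d sel x h ≤ sampleMean N d k := by
  refine sampleMean_mono fun S hS => ?_
  calc ∑ B : Finset (Fin N), (sel x S B).toReal * h B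
      ≤ ∑ B : Finset (Fin N), (sel x S B).toReal * k S := by
        refine Finset.sum_le_sum fun B _ => ?_
        by_cases hB : B ∈ (sel x S).support
        · exact mul_le_mul_of_nonneg_left (hk S B (hsel x S hS B hB)) ENNReal.toReal_nonneg
        · have : sel x S B = 0 := by simpa [PMF.mem_support_iff] using hB
          simp [this]
    _ = k S := by rw [← Finset.sum_mul, sum_sel_toReal, one_mul]

theorem batchMean_le_const (hd : d ≤ N)
    (hsel : ∀ x S, S.card = d → ∀ B ∈ (sel x S).support, IsShortestSelection ℓ x S B)
    (x : Fin N → ℕ) {h : Finset (Fin N) → ℝ} {c : ℝ}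
    (hk : ∀ B, B.card = ℓ → h B ≤ c) : batchMean d sel x h ≤ c :=
  (batchMean_le_sampleMean hsel x fun _ B hB => hk B hB.2.1).trans (sampleMean_const hd c).le

/-- A selection of shortest queues contains a busy server only if it contains all idle servers of
the sample. -/
theorem IsShortestSelection.card_busy_le {x : Fin N → ℕ} {S B : Finset (Fin N)}
    (h : IsShortestSelection ℓ x S B) :
    ((B.filter fun j => 0 < x j).card : ℝ) ≤
      max 0 ((ℓ : ℝ) - (S ∩ Finset.univ.filter fun j => x j = 0).card) := by
  obtain ⟨hBS, hcard, hle⟩ := h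
  rcases (B.filter fun j => 0 < x j).eq_empty_or_nonempty with h0 | ⟨i, hi⟩
  · rw [h0]; simp
  · rw [Finset.mem_filter] at hi
    have hsub : (S ∩ Finset.univ.filter fun j => x j = 0) ⊆ B.filter fun j => ¬ 0 < x j := by
      intro j hj
      simp only [Finset.mem_inter, Finset.mem_filter, Finset.mem_univ, true_and] at hj
      rw [Finset.mem_filter]
      refine ⟨?_, by lia⟩
      by_contra hjB
      have := hle i hi.1 j (Finset.mem_sdiff.2 ⟨hj.1, hjB⟩)
      lia
    have h1 := Finset.card_filter_add_card_filter_not (s := B) fun j => 0 < x j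
    have h2 := Finset.card_le_card hsub
    refine le_max_of_le_right ?_
    have h3 : (B.filter fun j => 0 < x j).card +
      (S ∩ Finset.univ.filter fun j => x j = 0).card ≤ ℓ := by lia
    have h4 : ((B.filter fun j => 0 < x j).card : ℝ) +
      (S ∩ Finset.univ.filter fun j => x j = 0).card ≤ ℓ := by exact_mod_cast h3
    linarith

/-- The mean number of tasks of a batch that exceed the number of idle servers in the sample. -/
def meanShortage (ℓ d : ℕ) (x : Fin N → ℕ) : ℝ :=
  sampleMean N d fun S => max 0 ((ℓ : ℝ) - (S ∩ Finset.univ.filter fun j => x j = 0).card)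

variable {b : ℕ∞} {rate : ℝ}

/-- The generator is a bounded operator. -/
theorem abs_batchGenerator_le (hd : d ≤ N) (hrate : 0 ≤ rate)
    (hsel : ∀ x S, S.card = d → ∀ B ∈ (sel x S).support, IsShortestSelection ℓ x S B)
    {f : (Fin N → ℕ) → ℝ} {C : ℝ} (hf : ∀ x, |f x| ≤ C) (x : Fin N → ℕ) :
    |batchGenerator ℓ d b rate sel f x| ≤ N * (2 * C) + rate / ℓ * (2 * C) := by
  have hC : 0 ≤ C := (abs_nonneg _).trans (hf x)
  have h2 : ∀ y, |f y - f x| ≤ 2 * C := fun y =>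
    (abs_sub _ _).trans (by linarith [hf y, hf x])
  have hr : 0 ≤ rate / ℓ := by positivity
  rw [batchGenerator_eq]
  refine (abs_add_le _ _).trans (add_le_add ?_ ?_)
  · calc |∑ j with 0 < x j, (f (removeTask x j) - f x)|
        ≤ ∑ j with 0 < x j, |f (removeTask x j) - f x| := Finset.abs_sum_le_sum_abs _ _
      _ ≤ ∑ j : Fin N, 2 * C := by
          refine (Finset.sum_le_sum fun j _ => h2 _).trans ?_
          exact Finset.sum_le_sum_of_subset_of_nonneg (Finset.filter_subset _ _)
            fun _ _ _ => by positivity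
      _ = N * (2 * C) := by simp
  · rw [abs_mul, abs_of_nonneg hr]
    refine mul_le_mul_of_nonneg_left (abs_le.2 ⟨?_, ?_⟩) hr
    · have := batchMean_le_const hd hsel x (h := fun B => -1 * (f (addBatch b x B) - f x))
        (c := 2 * C) fun B _ => by
          have := (abs_le.1 (h2 (addBatch b x B))).1
          linarith
      rw [batchMean_const_mul] at this
      linarith
    · exact batchMean_le_const hd hsel x fun B _ => (abs_le.1 (h2 _)).2

/-- The carré du champ of an average over the servers is small. -/
theorem batchGenerator_sq_sub_le (hd : d ≤ N) (hN : 0 < N) (hℓ : 0 < ℓ) (hrate : 0 ≤ rate)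
    (hsel : ∀ x S, S.card = d → ∀ B ∈ (sel x S).support, IsShortestSelection ℓ x S B)
    {g : ℕ → ℝ} (hg : IsTaskCount g) (x : Fin N → ℕ) :
    batchGenerator ℓ d b rate sel (fun y => queueMean g y ^ 2) x -
        2 * queueMean g x * batchGenerator ℓ d b rate sel (queueMean g) x ≤
      1 / N + rate / N * (ℓ / N) := by
  have hN' : (0 : ℝ) < N := by exact_mod_cast hN
  have hℓ' : (0 : ℝ) < ℓ := by exact_mod_cast hℓ
  set f := queueMean (N := N) g with hf
  have hid : batchGenerator ℓ d b rate sel (fun y => f y ^ 2) x -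
      2 * f x * batchGenerator ℓ d b rate sel f x =
      (∑ j with 0 < x j, (f (removeTask x j) - f x) ^ 2) +
        rate / ℓ * batchMean d sel x fun B => (f (addBatch b x B) - f x) ^ 2 := by
    have h1 : batchMean d sel x (fun B => (f (addBatch b x B) - f x) ^ 2) =
        batchMean d sel x (fun B => f (addBatch b x B) ^ 2 - f x ^ 2) -
          2 * f x * batchMean d sel x (fun B => f (addBatch b x B) - f x) := by
      rw [← batchMean_const_mul, ← batchMean_sub]
      congr 1
      ext B
      ring
    have h2 : ∑ j with 0 < x j, (f (removeTask x j) - f x) ^ 2 =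
        (∑ j with 0 < x j, (f (removeTask x j) ^ 2 - f x ^ 2)) -
          2 * f x * ∑ j with 0 < x j, (f (removeTask x j) - f x) := by
      rw [Finset.mul_sum, ← Finset.sum_sub_distrib]
      exact Finset.sum_congr rfl fun j _ => by ring
    rw [h1, h2, batchGenerator_eq, batchGenerator_eq]
    ring
  rw [hid]
  refine add_le_add ?_ ?_
  · calc ∑ j with 0 < x j, (f (removeTask x j) - f x) ^ 2
        ≤ ∑ j with 0 < x j, (1 / (N : ℝ)) ^ 2 := by
          refine Finset.sum_le_sum fun j _ => ?_
          rw [hf, queueMean_removeTask_sub, div_pow, div_pow]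
          have := hg.pred (x j)
          refine div_le_div_of_nonneg_right ?_ (by positivity)
          nlinarith
      _ ≤ ∑ j : Fin N, (1 / (N : ℝ)) ^ 2 :=
          Finset.sum_le_sum_of_subset_of_nonneg (Finset.filter_subset _ _)
            fun _ _ _ => by positivity
      _ = 1 / N := by
          rw [Finset.sum_const, Finset.card_univ, Fintype.card_fin, nsmul_eq_mul]
          field_simp
  · calc rate / ℓ * batchMean d sel x (fun B => (f (addBatch b x B) - f x) ^ 2)
        ≤ rate / ℓ * ((ℓ : ℝ) / N) ^ 2 := by
          refine mul_le_mul_of_nonneg_left (batchMean_le_const hd hsel x fun B hB => ?_)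
            (by positivity)
          rw [hf, queueMean_addBatch_sub, div_pow, div_pow]
          have h0 : 0 ≤ ∑ j ∈ B, (g (addBatch b x B j) - g (x j)) :=
            Finset.sum_nonneg fun j _ => (hg.addBatch b x B j).1
          have h1 : ∑ j ∈ B, (g (addBatch b x B j) - g (x j)) ≤ ℓ := by
            calc _ ≤ ∑ j ∈ B, (1 : ℝ) := Finset.sum_le_sum fun j _ => (hg.addBatch b x B j).2
              _ = ℓ := by simp [hB]
          gcongr
      _ = rate / N * (ℓ / N) := by field_simp

/-- Waiting tasks are created only by batches that do not find enough idle servers in their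
sample. -/
theorem batchGenerator_waiting_le (hrate : 0 ≤ rate)
    (hsel : ∀ x S, S.card = d → ∀ B ∈ (sel x S).support, IsShortestSelection ℓ x S B)
    (K : ℕ) (x : Fin N → ℕ) :
    batchGenerator ℓ d b rate sel (queueMean (waiting K)) x ≤
      rate / N * (meanShortage ℓ d x / ℓ) := by
  have h1 : ∑ j with 0 < x j,
      (queueMean (waiting K) (removeTask x j) - queueMean (waiting K) x) ≤ 0 := by
    refine Finset.sum_nonpos fun j _ => ?_
    rw [queueMean_removeTask_sub]
    have := ((isTaskCount_waiting K).pred (x j)).1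
    exact div_nonpos_of_nonpos_of_nonneg (by linarith) (by positivity)
  have h2 : batchMean d sel x
      (fun B => queueMean (waiting K) (addBatch b x B) - queueMean (waiting K) x) ≤
      (N : ℝ)⁻¹ * meanShortage ℓ d x := by
    rw [meanShortage, ← sampleMean_const_mul]
    refine batchMean_le_sampleMean hsel x fun S B hB => ?_
    rw [queueMean_addBatch_sub, inv_mul_eq_div]
    refine div_le_div_of_nonneg_right (le_trans ?_ hB.card_busy_le) (by positivity)
    rw [← Finset.sum_boole]
    refine Finset.sum_le_sum fun j _ => ?_
    split_ifs with hj
    · exact ((isTaskCount_waiting K).addBatch b x B j).2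
    · have hj0 : x j = 0 := by lia
      simp only [addBatch, hj0]
      split_ifs <;> simp [waiting]
  rw [batchGenerator_eq]
  calc _ ≤ 0 + rate / ℓ * ((N : ℝ)⁻¹ * meanShortage ℓ d x) :=
        add_le_add h1 (mul_le_mul_of_nonneg_left h2 (by positivity))
    _ = rate / N * (meanShortage ℓ d x / ℓ) := by ring

/-- The drift of the fraction of busy servers. -/
theorem abs_batchGenerator_busy_sub_le (hd : d ≤ N) (hℓ : 0 < ℓ) (hb : 1 ≤ b)
    (hrate : 0 ≤ rate)
    (hsel : ∀ x S, S.card = d → ∀ B ∈ (sel x S).support, IsShortestSelection ℓ x S B)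
    (x : Fin N → ℕ) :
    |batchGenerator ℓ d b rate sel (queueMean busy) x - (rate / N - queueMean busy x)| ≤
      queueMean (waiting 1) x + rate / N * (meanShortage ℓ d x / ℓ) := by
  have hℓ' : (0 : ℝ) < ℓ := by exact_mod_cast hℓ
  have h1 : ∑ j with 0 < x j, (queueMean busy (removeTask x j) - queueMean busy x) =
      queueMean (waiting 1) x - queueMean busy x := by
    simp only [queueMean_removeTask_sub]
    rw [Finset.sum_filter, queueMean, queueMean, ← sub_div, ← Finset.sum_sub_distrib,
      Finset.sum_div]
    refine Finset.sum_congr rfl fun j _ => ?_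
    rcases hj : x j with _ | _ | n <;> simp [busy, waiting]
  have hdiff : ∀ B : Finset (Fin N), B.card = ℓ →
      queueMean busy (addBatch b x B) - queueMean busy x =
        (N : ℝ)⁻¹ * (ℓ - (B.filter fun j => 0 < x j).card) := fun B hB => by
    rw [queueMean_addBatch_sub, inv_mul_eq_div]
    congr 1
    rw [← hB, ← Finset.sum_boole, Finset.card_eq_sum_ones, Nat.cast_sum, ← Finset.sum_sub_distrib]
    refine Finset.sum_congr rfl fun j hj => ?_
    rcases hx : x j with _ | n
    · have : (0 : ℕ∞) < b := zero_lt_one.trans_le hb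
      simp [addBatch, hj, hx, this, busy]
    · simp only [addBatch, hx]
      split_ifs <;> simp_all [busy]
  have h2 : batchMean d sel x (fun B => queueMean busy (addBatch b x B) - queueMean busy x) ≤
      ℓ / N := by
    refine batchMean_le_const hd hsel x fun B hB => ?_
    rw [hdiff B hB, inv_mul_eq_div]
    refine div_le_div_of_nonneg_right ?_ (by positivity)
    simp
  have h3 : -1 * batchMean d sel x
      (fun B => queueMean busy (addBatch b x B) - queueMean busy x) ≤
      (N : ℝ)⁻¹ * meanShortage ℓ d x + -(ℓ / N) := by
    rw [← batchMean_const_mul, meanShortage, ← sampleMean_const_mul,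
      ← sampleMean_const (N := N) hd (-((ℓ : ℝ) / N)), ← sampleMean_add]
    refine batchMean_le_sampleMean hsel x fun S B hB => ?_
    rw [hdiff B hB.2.1]
    have := mul_le_mul_of_nonneg_left hB.card_busy_le (by positivity : 0 ≤ (N : ℝ)⁻¹)
    rw [div_eq_inv_mul]
    linarith
  rw [batchGenerator_eq, h1]
  have hr : 0 ≤ rate / ℓ := by positivity
  have h4 := mul_le_mul_of_nonneg_left h2 hr
  have h5 := mul_le_mul_of_nonneg_left h3 hr
  have e1 : rate / ℓ * (ℓ / N) = rate / N := by field_simp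
  have e2 : rate / ℓ * ((N : ℝ)⁻¹ * meanShortage ℓ d x + -(ℓ / N)) =
      rate / N * (meanShortage ℓ d x / ℓ) - rate / N := by
    have : rate / ℓ * ((N : ℝ)⁻¹ * meanShortage ℓ d x + -(ℓ / N)) =
        rate / N * (meanShortage ℓ d x / ℓ) - rate / ℓ * (ℓ / N) := by ring
    rw [this, e1]
  rw [e1] at h4
  rw [e2] at h5
  have hw : 0 ≤ queueMean (waiting 1) x := by
    refine div_nonneg (Finset.sum_nonneg fun j _ => ?_) (by positivity)
    simp [waiting]
  have hs : 0 ≤ rate / N * (meanShortage ℓ d x / ℓ) := by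
    have : 0 ≤ meanShortage ℓ d x :=
      mul_nonneg (by positivity) (Finset.sum_nonneg fun S _ => le_max_left _ _)
    positivity
  rw [abs_le]
  constructor <;> linarith

/-- While the fraction of busy servers leaves room for the sampling ratio `ℓ / d`, the mean shortage
is bounded. -/
theorem meanShortage_le (hN : 0 < N) (hd : d ≤ N) (hℓ : 0 < ℓ) {c ρ : ℝ} (hc : 0 < c)
    (hρ : (1 + c) * ℓ ≤ d * ρ) {x : Fin N → ℕ} (hx : queueMean busy x ≤ 1 - ρ) :
    meanShortage ℓ d x ≤ (1 + c) / (4 * c) := by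
  have hN' : (0 : ℝ) < N := by exact_mod_cast hN
  refine sampleMean_shortage_le hN hd hℓ _ hc (hρ.trans ?_)
  have h1 : ((Finset.univ.filter fun j => x j = 0).card : ℝ) = N - N * queueMean busy x := by
    rw [queueMean, mul_div_cancel₀ _ hN'.ne', ← Finset.sum_boole]
    have : (N : ℝ) = ∑ _ : Fin N, (1 : ℝ) := by simp
    rw [this, ← Finset.sum_sub_distrib]
    refine Finset.sum_congr rfl fun j _ => ?_
    rcases x j with _ | n <;> simp [busy]
  rw [h1, mul_div_assoc]
  refine mul_le_mul_of_nonneg_left ?_ (by positivity)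
  rw [le_div_iff₀ hN']
  nlinarith

end Batch

/-! ### Deterministic stability of the fluid equation -/

/-- Gronwall's inequality in integral form, for a function that is merely right continuous. -/
theorem le_mul_exp_of_le_add_integral {u : ℝ → ℝ} (hm : Measurable u) {C c t : ℝ}
    (hu0 : ∀ s, 0 ≤ u s) (hub : ∀ s, |u s| ≤ C) (hc : ∀ s, 0 ≤ s → ContinuousWithinAt u (Set.Ici s) s)
    (h : ∀ s ∈ Set.Icc 0 t, u s ≤ c + ∫ r in (0 : ℝ)..s, u r) :
    ∀ s ∈ Set.Icc 0 t, u s ≤ c * Real.exp s := by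
  intro s hs
  have hc0 : 0 ≤ c := by
    have := h 0 ⟨le_rfl, hs.1.trans hs.2⟩
    rw [intervalIntegral.integral_same, add_zero] at this
    exact (hu0 0).trans this
  have hint0 : ∀ r, 0 ≤ r → 0 ≤ ∫ v in (0 : ℝ)..r, u v := fun r hr =>
    intervalIntegral.integral_nonneg hr fun v _ => hu0 v
  have hcont : Continuous fun r => c + ∫ v in (0 : ℝ)..r, u v :=
    continuous_const.add (intervalIntegral.continuous_primitive
      (fun _ _ => intervalIntegrable_of_abs_le hm hub _ _) 0)
  have := norm_le_gronwallBound_of_norm_deriv_right_le (f := fun r => c + ∫ v in (0 : ℝ)..r, u v)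
    (f' := u) (δ := c) (K := 1) (ε := 0) (a := 0) (b := t) hcont.continuousOn
    (fun r hr => (hasDerivWithinAt_integral_of_rightContinuous hm hub (hc r hr.1)).const_add c)
    (by simp [abs_of_nonneg hc0])
    (fun r hr => by
      rw [Real.norm_of_nonneg (hu0 r), Real.norm_of_nonneg (add_nonneg hc0 (hint0 r hr.1)), one_mul,
        add_zero]
      exact h r ⟨hr.1, hr.2.le⟩) s hs
  rw [gronwallBound_ε0, Real.norm_of_nonneg (add_nonneg hc0 (hint0 s hs.1)), one_mul,
    sub_zero] at this
  exact (h s hs).trans this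

theorem integral_le_mul_of_forall_Ico_le {a : ℝ → ℝ} (hm : Measurable a) {C η t : ℝ}
    (hb : ∀ s, |a s| ≤ C) (ht : 0 ≤ t) (h : ∀ s ∈ Set.Ico 0 t, a s ≤ η) :
    ∫ s in (0 : ℝ)..t, a s ≤ η * t := by
  calc ∫ s in (0 : ℝ)..t, a s ≤ ∫ _ in (0 : ℝ)..t, η :=
        intervalIntegral.integral_mono_on_of_le_Ioo ht (intervalIntegrable_of_abs_le hm hb _ _)
          intervalIntegrable_const fun s hs => h s ⟨hs.1.le, hs.2⟩
    _ = η * t := by simp [mul_comm]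

theorem integral_limit_drift (lam q₁ t : ℝ) :
    ∫ s in (0 : ℝ)..t, (lam - (lam + (q₁ - lam) * Real.exp (-s))) =
      lam + (q₁ - lam) * Real.exp (-t) - q₁ := by
  have := intervalIntegral.integral_eq_sub_of_hasDerivAt (a := 0) (b := t)
    (f := fun s => lam + (q₁ - lam) * Real.exp (-s))
    (f' := fun s => lam - (lam + (q₁ - lam) * Real.exp (-s)))
    (fun s _ => by
      have := (((hasDerivAt_neg s).exp).const_mul (q₁ - lam)).const_add lam
      exact this.congr_deriv (by ring))
    (by apply Continuous.intervalIntegrable; fun_prop)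
  rw [this]
  simp

/-- If, as long as `x₁` is below a threshold above `λ`, the drift of `x₁` is close to `λ - x₁` up to
`x₂`, and that of `x₂` is nearly nonpositive, then `x₁` never reaches the threshold and stays close
to the solution of `q' = λ - q`. The first passage over the threshold is excluded because the
Gronwall estimate holds up to and including that time. -/
theorem abs_sub_limit_le {x₁ x₂ a₁ a₂ : ℝ → ℝ} {C T η lam q₁ thr : ℝ} (hT : 0 ≤ T) (hη : 0 ≤ η)
    (hx₁m : Measurable x₁) (ha₁m : Measurable a₁) (ha₂m : Measurable a₂)
    (hx₁b : ∀ s, |x₁ s| ≤ C) (ha₁b : ∀ s, |a₁ s| ≤ C) (ha₂b : ∀ s, |a₂ s| ≤ C)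
    (hx₁c : ∀ t, 0 ≤ t → ContinuousWithinAt x₁ (Set.Ici t) t)
    (h₁ : ∀ t ∈ Set.Icc 0 T, |x₁ t - x₁ 0 - ∫ s in (0 : ℝ)..t, a₁ s| ≤ η)
    (h₂ : ∀ t ∈ Set.Icc 0 T, x₂ t - x₂ 0 - ∫ s in (0 : ℝ)..t, a₂ s ≤ η)
    (hdrift₁ : ∀ s, x₁ s ≤ thr → |a₁ s - (lam - x₁ s)| ≤ x₂ s + η)
    (hdrift₂ : ∀ s, x₁ s ≤ thr → a₂ s ≤ η)
    (hinit₁ : |x₁ 0 - q₁| ≤ η) (hinit₂ : x₂ 0 ≤ η) (hq : q₁ ≤ lam)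
    (hsmall : (2 + 3 * T + T ^ 2) * η * Real.exp T < thr - lam) :
    ∀ t ∈ Set.Icc 0 T, x₁ t ≤ thr ∧
      |x₁ t - (lam + (q₁ - lam) * Real.exp (-t))| ≤ (2 + 3 * T + T ^ 2) * η * Real.exp T := by
  set q : ℝ → ℝ := fun t => lam + (q₁ - lam) * Real.exp (-t) with hqdef
  have hqle : ∀ t, q t ≤ lam := fun t => by
    have := mul_nonneg (sub_nonneg.2 hq) (Real.exp_pos (-t)).le
    simp only [hqdef]
    linarith
  have hqcont : Continuous q := by fun_prop
  have hqb : ∀ s, 0 ≤ s → |q s| ≤ |lam| + |q₁ - lam| := fun s hs => by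
    refine (abs_add_le _ _).trans (add_le_add_right ?_ _)
    rw [abs_mul, Real.abs_exp]
    exact mul_le_of_le_one_right (abs_nonneg _) (Real.exp_le_one_iff.2 (by linarith))
  -- the estimate, as long as the threshold has not been passed
  have key : ∀ t ∈ Set.Icc 0 T, (∀ s ∈ Set.Ico 0 t, x₁ s ≤ thr) →
      |x₁ t - q t| ≤ (2 + 3 * T + T ^ 2) * η * Real.exp T := by
    intro t ht hthr
    have hx₂ : ∀ s ∈ Set.Icc 0 t, x₂ s ≤ (2 + T) * η := fun s hs => by
      have h3 := h₂ s ⟨hs.1, hs.2.trans ht.2⟩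
      have h4 := integral_le_mul_of_forall_Ico_le ha₂m ha₂b hs.1 (η := η) fun r hr =>
        hdrift₂ r (hthr r ⟨hr.1, hr.2.trans_le hs.2⟩)
      have h5 : η * s ≤ η * T := mul_le_mul_of_nonneg_left (hs.2.trans ht.2) hη
      linarith
    -- bounded on all of `ℝ`, as `q` is evaluated at nonnegative times only
    let u : ℝ → ℝ := fun s => |x₁ s - q (max s 0)|
    have hum : Measurable u := by
      have : Measurable fun s => q (max s 0) := (hqcont.comp (by fun_prop)).measurable
      exact (hx₁m.sub this).abs
    have hub : ∀ s, |u s| ≤ C + (|lam| + |q₁ - lam|) := fun s => by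
      rw [abs_abs]
      exact (abs_sub _ _).trans (add_le_add (hx₁b s) (hqb _ (le_max_right _ _)))
    have huc : ∀ s, 0 ≤ s → ContinuousWithinAt u (Set.Ici s) s := fun s hs =>
      ((hx₁c s hs).sub (hqcont.comp (by fun_prop : Continuous fun s : ℝ => max s 0)
        ).continuousWithinAt).abs
    have hgr := le_mul_exp_of_le_add_integral hum (c := (2 + 3 * T + T ^ 2) * η) (t := t)
      (fun s => abs_nonneg _) hub huc fun s hs => by
        have hsT : s ∈ Set.Icc 0 T := ⟨hs.1, hs.2.trans ht.2⟩
        have hdi : IntervalIntegrable (fun r => a₁ r - (lam - q r)) volume 0 s :=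
          (intervalIntegrable_of_abs_le ha₁m ha₁b _ _).sub
            (by apply Continuous.intervalIntegrable; fun_prop)
        have hui : IntervalIntegrable u volume 0 s := intervalIntegrable_of_abs_le hum hub _ _
        have hI : |∫ r in (0 : ℝ)..s, (a₁ r - (lam - q r))| ≤
            (3 + T) * η * T + ∫ r in (0 : ℝ)..s, u r := by
          calc |∫ r in (0 : ℝ)..s, (a₁ r - (lam - q r))|
              ≤ ∫ r in (0 : ℝ)..s, |a₁ r - (lam - q r)| :=
                intervalIntegral.abs_integral_le_integral_abs hs.1
            _ ≤ ∫ r in (0 : ℝ)..s, ((3 + T) * η + u r) := by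
                refine intervalIntegral.integral_mono_on_of_le_Ioo hs.1 hdi.abs
                  (intervalIntegrable_const.add hui) fun r hr => ?_
                have h3 := hdrift₁ r (hthr r ⟨hr.1.le, hr.2.trans_le hs.2⟩)
                have h4 := hx₂ r ⟨hr.1.le, hr.2.le.trans hs.2⟩
                have h5 : a₁ r - (lam - q r) = (a₁ r - (lam - x₁ r)) + -(x₁ r - q r) := by ring
                have h6 : u r = |x₁ r - q r| := by simp only [u, max_eq_left hr.1.le]
                rw [h5, h6]
                refine (abs_add_le _ _).trans ?_
                rw [abs_neg]
                linarith
            _ = (3 + T) * η * s + ∫ r in (0 : ℝ)..s, u r := by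
                rw [intervalIntegral.integral_add intervalIntegrable_const hui,
                  intervalIntegral.integral_const, smul_eq_mul, sub_zero, mul_comm s]
            _ ≤ (3 + T) * η * T + ∫ r in (0 : ℝ)..s, u r := by
                have : (3 + T) * η * s ≤ (3 + T) * η * T :=
                  mul_le_mul_of_nonneg_left hsT.2 (by positivity)
                linarith
        have h7 : x₁ s - q s = (x₁ 0 - q₁) + ((x₁ s - x₁ 0 - ∫ r in (0 : ℝ)..s, a₁ r) +
            ∫ r in (0 : ℝ)..s, (a₁ r - (lam - q r))) := by
          have h8 : ∫ r in (0 : ℝ)..s, (lam - q r) = q s - q₁ := integral_limit_drift lam q₁ s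
          rw [intervalIntegral.integral_sub (intervalIntegrable_of_abs_le ha₁m ha₁b _ _)
            (by apply Continuous.intervalIntegrable; fun_prop), h8]
          ring
        have h8 : u s = |x₁ s - q s| := by simp only [u, max_eq_left hs.1]
        rw [h8, h7]
        have h9 := abs_add_le (x₁ 0 - q₁) ((x₁ s - x₁ 0 - ∫ r in (0 : ℝ)..s, a₁ r) +
            ∫ r in (0 : ℝ)..s, (a₁ r - (lam - q r)))
        have h10 := abs_add_le (x₁ s - x₁ 0 - ∫ r in (0 : ℝ)..s, a₁ r)
            (∫ r in (0 : ℝ)..s, (a₁ r - (lam - q r)))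
        have h11 := h₁ s hsT
        nlinarith
    have h3 := hgr t ⟨ht.1, le_rfl⟩
    have h4 : u t = |x₁ t - q t| := by simp only [u, max_eq_left ht.1]
    rw [h4] at h3
    refine h3.trans (mul_le_mul_of_nonneg_left (Real.exp_le_exp.2 ht.2) (by positivity))
  have hthr : ∀ t ∈ Set.Icc 0 T, x₁ t ≤ thr := by
    by_contra! hcon
    let B := {t | t ∈ Set.Icc 0 T ∧ thr < x₁ t}
    have hBne : B.Nonempty := hcon
    have hBbdd : BddBelow B := ⟨0, fun t ht => ht.1.1⟩
    have hσ0 : 0 ≤ sInf B := le_csInf hBne fun t ht => ht.1.1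
    have hσT : sInf B ≤ T := by
      obtain ⟨t, ht⟩ := hBne
      exact (csInf_le hBbdd ht).trans ht.1.2
    have h3 := key (sInf B) ⟨hσ0, hσT⟩ fun s hs => by
      by_contra! hs'
      exact notMem_of_lt_csInf hs.2 hBbdd ⟨⟨hs.1, hs.2.le.trans hσT⟩, hs'⟩
    have h4 : x₁ (sInf B) < thr := by
      have := (abs_le.1 h3).2
      have := hqle (sInf B)
      linarith
    have h5 : ∀ᶠ s in 𝓝[≥] (sInf B), x₁ s < thr :=
      (hx₁c _ hσ0).eventually (eventually_lt_nhds h4)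
    have h6 : (𝓝[B] (sInf B)).NeBot :=
      mem_closure_iff_nhdsWithin_neBot.1 (csInf_mem_closure hBne hBbdd)
    have h7 : ∀ᶠ s in 𝓝[B] (sInf B), x₁ s < thr :=
      h5.filter_mono (nhdsWithin_mono _ fun s hs => csInf_le hBbdd hs)
    obtain ⟨s, hs, hsB⟩ := (h7.and self_mem_nhdsWithin).exists
    exact absurd hs hsB.2.le.not_gt
  exact fun t ht => ⟨hthr t ht, key t ht fun s hs => hthr s ⟨hs.1, hs.2.le.trans ht.2⟩⟩

/-! ### The queueing process -/

theorem SkorokhodSpace.continuousWithinAt_comp {E : Type*} [TopologicalSpace E] [DiscreteTopology E]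
    (x : SkorokhodSpace E) (φ : E → ℝ) (t : ℝ≥0) :
    ContinuousWithinAt (fun s => φ (x s)) (Set.Ici t) t :=
  (continuous_of_discreteTopology (f := φ)).continuousAt.comp_continuousWithinAt (x.isCadlag t).1

/-- A right-continuous function of a real variable is measurable. -/
theorem measurable_of_rightContinuous {g : ℝ≥0 → ℝ}
    (hg : ∀ t, ContinuousWithinAt g (Set.Ici t) t) : Measurable fun s : ℝ => g s.toNNReal := by
  have := measurable_uncurry_of_rightContinuous (Ω := Unit) (Y := fun t _ => g t)
    (fun t => measurable_const) fun _ t => hg t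
  exact this.comp (measurable_real_toNNReal.prodMk (measurable_const (a := ())))

theorem abs_queueMean_le {N : ℕ} {g : ℕ → ℝ} {G : ℝ} (hG : ∀ n, |g n| ≤ G) (x : Fin N → ℕ) :
    |queueMean g x| ≤ G := by
  have hG0 : 0 ≤ G := (abs_nonneg _).trans (hG 0)
  rcases Nat.eq_zero_or_pos N with rfl | hN
  · simpa [queueMean] using hG0
  · have hN' : (0 : ℝ) < N := by exact_mod_cast hN
    rw [queueMean, abs_div, abs_of_pos hN', div_le_iff₀ hN']
    calc |∑ j, g (x j)| ≤ ∑ j, |g (x j)| := Finset.abs_sum_le_sum_abs _ _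
      _ ≤ ∑ _ : Fin N, G := Finset.sum_le_sum fun j _ => hG _
      _ = G * N := by simp [mul_comm]

theorem abs_busy_le (n : ℕ) : |busy n| ≤ 1 := by
  rcases n with _ | n <;> simp [busy]

theorem abs_waiting_le (K n : ℕ) : |waiting K n| ≤ K := by
  rw [waiting, Nat.abs_cast]
  exact_mod_cast min_le_right _ _

/-- The deviation of an average over the servers from its compensator, up to time `T`, is small in
probability, uniformly over the bounded functions averaged. -/
theorem measure_compensated_queueMean_le {Ω : Type*} [mΩ : MeasurableSpace Ω] {P : Measure Ω}
    [IsProbabilityMeasure P] {N ℓ d : ℕ} {b : ℕ∞} {rate : ℝ} {X : Ω → SkorokhodSpace (Fin N → ℕ)}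
    {sel : (Fin N → ℕ) → Finset (Fin N) → PMF (Finset (Fin N))} {ℱ : Filtration ℝ≥0 mΩ}
    (hN : 0 < N) (hd : d ≤ N) (hℓ : 0 < ℓ) (hrate : 0 ≤ rate)
    (hsel : ∀ x S, S.card = d → ∀ B ∈ (sel x S).support, IsShortestSelection ℓ x S B)
    (hXm : ∀ t, Measurable[ℱ t] fun ω => X ω t)
    (hmart : ∀ f : (Fin N → ℕ) → ℝ, (∃ C, ∀ x, |f x| ≤ C) →
      Martingale (fun (t : ℝ≥0) ω => f (X ω t) -
        ∫ s in (0 : ℝ)..t, batchGenerator ℓ d b rate sel f (X ω s.toNNReal)) ℱ P)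
    {g : ℕ → ℝ} (hg : IsTaskCount g) {G : ℝ} (hG : ∀ n, |g n| ≤ G) (T : ℝ≥0) {η : ℝ}
    (hη : 0 < η) :
    P {ω | ∃ t ≤ T, η < |queueMean g (X ω t) - queueMean g (X ω 0) -
      ∫ s in (0 : ℝ)..t, batchGenerator ℓ d b rate sel (queueMean g) (X ω s.toNNReal)|} ≤
      ENNReal.ofReal (√((1 / N + rate / N * (ℓ / N)) * T) / η) := by
  set f := queueMean (N := N) g with hf
  set L := batchGenerator ℓ d b rate sel with hL
  have hfb : ∀ x, |f x| ≤ G := abs_queueMean_le hG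
  have hG0 : 0 ≤ G := (abs_nonneg _).trans (hG 0)
  have hf2b : ∀ x, |f x ^ 2| ≤ G ^ 2 := fun x => by
    rw [abs_pow]
    exact pow_le_pow_left₀ (abs_nonneg _) (hfb x) 2
  have hLf := abs_batchGenerator_le (b := b) hd hrate hsel hfb
  have hLf2 := abs_batchGenerator_le (b := b) hd hrate hsel hf2b
  set C₁ : ℝ := N * (2 * G) + rate / ℓ * (2 * G)
  set C₂ : ℝ := N * (2 * G ^ 2) + rate / ℓ * (2 * G ^ 2)
  have hφm : ∀ (φ : (Fin N → ℕ) → ℝ) t, Measurable[ℱ t] fun ω => φ (X ω t) := fun φ t =>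
    (Measurable.of_discrete (f := φ)).comp (hXm t)
  have hM := hmart f ⟨G, hfb⟩
  have hM₂ := hmart (fun x => f x ^ 2) ⟨G ^ 2, hf2b⟩
  have hsq := integral_sq_compensated_le (P := P) (ℱ := ℱ) (f := fun t ω => f (X ω t))
    (a := fun t ω => L f (X ω t)) (a₂ := fun t ω => L (fun x => f x ^ 2) (X ω t))
    (C := max G (max C₁ C₂)) (K := 1 / N + rate / N * (ℓ / N))
    (hφm f) (hφm (L f)) (hφm (L fun x => f x ^ 2))
    (fun ω t => (X ω).continuousWithinAt_comp _ t) (fun ω t => (X ω).continuousWithinAt_comp _ t)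
    (fun ω t => (X ω).continuousWithinAt_comp _ t)
    (fun t ω => (hfb _).trans (le_max_left _ _))
    (fun t ω => (hLf _).trans ((le_max_left _ _).trans (le_max_right _ _)))
    (fun t ω => (hLf2 _).trans ((le_max_right _ _).trans (le_max_right _ _)))
    (fun t ω => batchGenerator_sq_sub_le hd hN hℓ hrate hsel hg _) hM hM₂ T
  let M : ℝ≥0 → Ω → ℝ := fun t ω => f (X ω t) - f (X ω 0) -
    ∫ s in (0 : ℝ)..t, L f (X ω s.toNNReal)
  have hM0 : Martingale (fun (_ : ℝ≥0) ω => f (X ω 0)) ℱ P := by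
    have hm : Measurable[ℱ 0] fun ω => f (X ω 0) := hφm f 0
    have hi : Integrable (fun ω => f (X ω 0)) P :=
      Integrable.of_bound (hm.mono (ℱ.le 0) le_rfl).aestronglyMeasurable G
        (Eventually.of_forall fun ω => hfb _)
    exact martingale_const_fun ℱ P hm.stronglyMeasurable hi
  have hMM : Martingale M ℱ P := by
    have h := hM.sub hM0
    convert h using 1
    ext t ω
    simp only [M, Pi.sub_apply]
    ring
  have hMc : ∀ ω t, ContinuousWithinAt (fun s => M s ω) (Set.Ici t) t := fun ω t => by
    have h1 : Measurable fun s : ℝ => L f (X ω s.toNNReal) :=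
      measurable_of_rightContinuous fun t => (X ω).continuousWithinAt_comp _ t
    have h2 : Continuous fun t : ℝ≥0 => ∫ s in (0 : ℝ)..t, L f (X ω s.toNNReal) :=
      (intervalIntegral.continuous_primitive
        (fun _ _ => intervalIntegrable_of_abs_le h1 (fun s => hLf _) _ _) 0).comp
        NNReal.continuous_coe
    exact (((X ω).continuousWithinAt_comp f t).sub continuousWithinAt_const).sub
      h2.continuousWithinAt
  refine (measure_exists_lt_abs_le hMM hMc T hη).trans (ENNReal.ofReal_le_ofReal ?_)
  refine div_le_div_of_nonneg_right ?_ hη.le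
  have hMb : ∀ ω, |M T ω| ≤ G + G + C₁ * T := fun ω => by
    have h3 := intervalIntegral.norm_integral_le_of_norm_le_const (a := (0 : ℝ)) (b := T)
      (f := fun s => L f (X ω s.toNNReal)) (C := C₁) fun s _ => hLf _
    rw [sub_zero, abs_of_nonneg (NNReal.coe_nonneg T)] at h3
    exact (abs_sub _ _).trans (add_le_add ((abs_sub _ _).trans (add_le_add (hfb _) (hfb _))) h3)
  have hM2i : Integrable (fun ω => M T ω ^ 2) P := by
    refine Integrable.of_bound ((hMM.integrable T).aestronglyMeasurable.pow 2)
      ((G + G + C₁ * T) ^ 2) (Eventually.of_forall fun ω => ?_)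
    rw [Real.norm_eq_abs, abs_pow]
    exact pow_le_pow_left₀ (abs_nonneg _) (hMb ω) 2
  exact (integral_abs_le_sqrt_integral_sq (hMM.integrable T) hM2i).trans (Real.sqrt_le_sqrt hsq)

/-- The fluid approximation for one system, with an explicit bound on the probability that it
fails. The bound depends on `K` through the initial state only. -/
theorem IsBatchJSQProcess.measure_deviation_le {Ω : Type*} [mΩ : MeasurableSpace Ω]
    {P : Measure Ω} [IsProbabilityMeasure P] {N ℓ d : ℕ} {b : ℕ∞} {rate : ℝ}
    {X : Ω → SkorokhodSpace (Fin N → ℕ)} (hX : IsBatchJSQProcess P N ℓ d b rate X)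
    (hN : 0 < N) (hd : d ≤ N) (hℓ : 0 < ℓ) (hrate : 0 ≤ rate) (hb : 1 ≤ b)
    {lam q₁ thr η : ℝ} (T : ℝ≥0) (hη : 0 < η) (hq : q₁ ≤ lam)
    (hsmall : (2 + 3 * (T : ℝ) + (T : ℝ) ^ 2) * η * Real.exp T < thr - lam)
    (hdrift : |rate / N - lam| ≤ η / 2)
    (hshort : ∀ x : Fin N → ℕ, queueMean busy x ≤ thr →
      rate / N * (meanShortage ℓ d x / ℓ) ≤ η / 2) (K : ℕ) :
    P {ω | ∃ t ≤ T, (2 + 3 * (T : ℝ) + (T : ℝ) ^ 2) * η * Real.exp T <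
        |queueMean busy (X ω t) - limitQ1 lam q₁ t| ∨
        (2 + (T : ℝ)) * η < queueMean (waiting K) (X ω t)} ≤
      3 * ENNReal.ofReal (√((1 / N + rate / N * (ℓ / N)) * T) / η) +
        P {ω | η < |queueMean busy (X ω 0) - q₁|} + P {ω | η < queueMean (waiting 1) (X ω 0)} +
        P {ω | η < queueMean (waiting K) (X ω 0)} := by
  obtain ⟨-, sel, ℱ, hsel, hXm, hmart⟩ := hX
  let L := batchGenerator ℓ d b rate sel
  let bad : (ℕ → ℝ) → Set Ω := fun g => {ω | ∃ t ≤ T, η < |queueMean g (X ω t) -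
    queueMean g (X ω 0) - ∫ s in (0 : ℝ)..t, L (queueMean g) (X ω s.toNNReal)|}
  have hbad : ∀ g, IsTaskCount g → ∀ G, (∀ n, |g n| ≤ G) → P (bad g) ≤
      ENNReal.ofReal (√((1 / N + rate / N * (ℓ / N)) * T) / η) := fun g hg G hG =>
    measure_compensated_queueMean_le hN hd hℓ hrate hsel hXm hmart hg hG T hη
  have hsub : {ω | ∃ t ≤ T, (2 + 3 * (T : ℝ) + (T : ℝ) ^ 2) * η * Real.exp T <
        |queueMean busy (X ω t) - limitQ1 lam q₁ t| ∨
        (2 + (T : ℝ)) * η < queueMean (waiting K) (X ω t)} ⊆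
      (((((bad busy ∪ bad (waiting 1)) ∪ bad (waiting K)) ∪
        {ω | η < |queueMean busy (X ω 0) - q₁|}) ∪ {ω | η < queueMean (waiting 1) (X ω 0)}) ∪
        {ω | η < queueMean (waiting K) (X ω 0)}) := by
    intro ω hω
    by_contra hcon
    simp only [Set.mem_union, Set.mem_ofPred_eq, not_or, not_lt, bad, not_exists, not_and] at hcon
    obtain ⟨⟨⟨⟨⟨g1, g2⟩, g3⟩, i1⟩, i2⟩, i3⟩ := hcon
    -- on the complement of the exceptional events the fluid estimate is pathwise
    have hLb : ∀ (g : ℕ → ℝ) (G : ℝ), (∀ n, |g n| ≤ G) → ∀ x,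
        |L (queueMean g) x| ≤ N * (2 * G) + rate / ℓ * (2 * G) := fun g G hG =>
      abs_batchGenerator_le hd hrate hsel (abs_queueMean_le hG)
    have hm : ∀ φ : (Fin N → ℕ) → ℝ, Measurable fun s : ℝ => φ (X ω s.toNNReal) := fun φ =>
      measurable_of_rightContinuous fun t => (X ω).continuousWithinAt_comp φ t
    have hwait : ∀ (k : ℕ) (s : ℝ), queueMean busy (X ω s.toNNReal) ≤ thr →
        L (queueMean (waiting k)) (X ω s.toNNReal) ≤ η := fun k s hs =>
      (batchGenerator_waiting_le hrate hsel k _).trans ((hshort _ hs).trans (by linarith))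
    have hrt : ∀ t ∈ Set.Icc (0 : ℝ) T, ∃ t' : ℝ≥0, t' ≤ T ∧ (t' : ℝ) = t := fun t ht =>
      ⟨⟨t, ht.1⟩, ht.2, rfl⟩
    have hC := abs_sub_limit_le (x₁ := fun s => queueMean busy (X ω s.toNNReal))
      (x₂ := fun s => queueMean (waiting 1) (X ω s.toNNReal))
      (a₁ := fun s => L (queueMean busy) (X ω s.toNNReal))
      (a₂ := fun s => L (queueMean (waiting 1)) (X ω s.toNNReal))
      (C := max 1 (N * (2 * 1) + rate / ℓ * (2 * 1))) (T := T) (η := η) (lam := lam) (q₁ := q₁)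
      (thr := thr) T.2 hη.le (hm _) (hm _) (hm _)
      (fun s => (abs_queueMean_le abs_busy_le _).trans (le_max_left _ _))
      (fun s => (hLb _ _ abs_busy_le _).trans (le_max_right _ _))
      (fun s => (hLb _ _ (fun n => by simpa using abs_waiting_le 1 n) _).trans (le_max_right _ _))
      (fun t _ => continuousWithinAt_comp_toNNReal
        (fun t => (X ω).continuousWithinAt_comp (queueMean busy) t) t)
      (fun t ht => by
        obtain ⟨t, htT, rfl⟩ := hrt t ht
        simpa using g1 t htT)
      (fun t ht => by
        obtain ⟨t, htT, rfl⟩ := hrt t ht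
        simpa using (abs_le.1 (g2 t htT)).2)
      (fun s hs => by
        have h1 := abs_batchGenerator_busy_sub_le hd hℓ hb hrate hsel (X ω s.toNNReal)
        have h2 := hshort _ hs
        have h3 := abs_add_le (L (queueMean busy) (X ω s.toNNReal) -
          (rate / N - queueMean busy (X ω s.toNNReal))) (rate / N - lam)
        have h4 : L (queueMean busy) (X ω s.toNNReal) -
            (lam - queueMean busy (X ω s.toNNReal)) =
            (L (queueMean busy) (X ω s.toNNReal) -
              (rate / N - queueMean busy (X ω s.toNNReal))) + (rate / N - lam) := by ring
        rw [h4]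
        linarith)
      (fun s hs => hwait 1 s hs) (by simpa using i1) (by simpa using i2) hq hsmall
    -- below the threshold the drift of the waiting tasks is at most `η` for every truncation level
    obtain ⟨t, htT, h | h⟩ := hω
    · have := (hC t ⟨t.2, htT⟩).2
      rw [Real.toNNReal_coe] at this
      exact absurd h (not_lt.2 this)
    · have h1 := (abs_le.1 (g3 t htT)).2
      have h2 := integral_le_mul_of_forall_Ico_le (hm (L (queueMean (waiting K))))
        (fun s => hLb _ _ (abs_waiting_le K) _) (NNReal.coe_nonneg t) (η := η) fun s hs =>
          hwait K s (hC s ⟨hs.1, hs.2.le.trans (by exact_mod_cast htT)⟩).1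
      have h3 : η * (t : ℝ) ≤ η * T := mul_le_mul_of_nonneg_left (by exact_mod_cast htT) hη.le
      linarith
  refine (measure_mono hsub).trans ?_
  refine (measure_union_le _ _).trans (add_le_add ?_ le_rfl)
  refine (measure_union_le _ _).trans (add_le_add ?_ le_rfl)
  refine (measure_union_le _ _).trans (add_le_add ?_ le_rfl)
  refine (measure_union_le _ _).trans ?_
  refine (add_le_add (measure_union_le _ _) le_rfl).trans ?_
  refine (add_le_add (add_le_add (hbad _ isTaskCount_busy _ abs_busy_le)
    (hbad _ (isTaskCount_waiting 1) _ (abs_waiting_le 1)))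
    (hbad _ (isTaskCount_waiting K) _ (abs_waiting_le K))).trans (le_of_eq ?_)
  ring

/-! ### Occupancy states -/

theorem queueMean_mono {N : ℕ} {g g' : ℕ → ℝ} {x : Fin N → ℕ} (h : ∀ j, g (x j) ≤ g' (x j)) :
    queueMean g x ≤ queueMean g' x :=
  div_le_div_of_nonneg_right (Finset.sum_le_sum fun j _ => h j) (by positivity)

theorem queueMean_waiting_mono {N : ℕ} (x : Fin N → ℕ) :
    Monotone fun K => queueMean (waiting K) x := fun K K' h =>
  queueMean_mono fun j => by
    simp only [waiting]
    exact_mod_cast (by lia : min (x j - 1) K ≤ min (x j - 1) K')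

theorem queueMean_waiting_nonneg {N : ℕ} (K : ℕ) (x : Fin N → ℕ) :
    0 ≤ queueMean (waiting K) x :=
  div_nonneg (Finset.sum_nonneg fun j _ => by simp [waiting]) (by positivity)

/-- With buffers of size `n`, at most `n` tasks wait at a server with a waiting task. -/
theorem queueMean_waiting_le_mul {N n : ℕ} {x : Fin N → ℕ} (hx : ∀ j, x j ≤ n) (K : ℕ) :
    queueMean (waiting K) x ≤ n * queueMean (waiting 1) x := by
  have h : (n : ℝ) * queueMean (waiting 1) x = queueMean (fun m => n * waiting 1 m) x := by
    simp only [queueMean, ← Finset.mul_sum]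
    ring
  rw [h]
  refine queueMean_mono fun j => ?_
  simp only [waiting]
  have : min (x j - 1) K ≤ n * min (x j - 1) 1 := by
    have := hx j
    rcases Nat.eq_zero_or_pos (x j - 1) with h0 | h0
    · simp [h0]
    · rw [min_eq_right (b := 1) h0, mul_one]
      lia
  exact_mod_cast this

theorem fluidOccupancy_nonneg {N : ℕ} (x : Fin N → ℕ) (i : ℕ) : 0 ≤ fluidOccupancy x i := by
  unfold fluidOccupancy
  positivity

theorem fluidOccupancy_add_two_le {N : ℕ} (x : Fin N → ℕ) (k : ℕ) :
    fluidOccupancy x (k + 2) ≤ queueMean (waiting 1) x := by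
  rw [fluidOccupancy_eq_queueMean, queueMean_waiting_one, fluidOccupancy_eq_queueMean]
  refine queueMean_mono fun j => ?_
  split_ifs with h1 h2 h2
  · exact le_rfl
  · lia
  · exact zero_le_one
  · exact le_rfl

theorem single_sub_fluidStateL1_apply {N : ℕ} (x : Fin N → ℕ) (c : ℝ) (k : ℕ) :
    (lp.single (E := fun _ : ℕ => ℝ) 1 0 c - fluidStateL1 x) k =
      (Pi.single 0 c : ℕ → ℝ) k - fluidOccupancy x (k + 1) := rfl

theorem dist_single_fluidStateL1_le {N : ℕ} {x : Fin N → ℕ} {c δ δ' : ℝ}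
    (h0 : |queueMean busy x - c| ≤ δ) (h : ∀ K, queueMean (waiting K) x ≤ δ') :
    dist (lp.single (E := fun _ : ℕ => ℝ) 1 0 c) (fluidStateL1 x) ≤ δ + δ' := by
  have hδ : 0 ≤ δ := (abs_nonneg _).trans h0
  have hδ' : 0 ≤ δ' := (queueMean_waiting_nonneg 0 x).trans (h 0)
  rw [dist_eq_norm]
  refine lp.norm_le_of_forall_sum_le (by simp) (by positivity) fun s => ?_
  obtain ⟨K, hK⟩ := s.exists_nat_subset_range
  have hK' : s ⊆ Finset.range (K + 1) := hK.trans (Finset.range_mono (Nat.le_succ K))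
  simp only [ENNReal.toReal_one, Real.rpow_one]
  refine (Finset.sum_le_sum_of_subset_of_nonneg hK' fun _ _ _ => norm_nonneg _).trans ?_
  rw [Finset.sum_range_succ', add_comm]
  refine add_le_add ?_ ?_
  · rw [← fluidOccupancy_one, abs_sub_comm] at h0
    simpa [single_sub_fluidStateL1_apply] using h0
  · refine le_trans (le_of_eq ?_) (h K)
    rw [queueMean_waiting]
    refine Finset.sum_congr rfl fun k _ => ?_
    simp [single_sub_fluidStateL1_apply, abs_of_nonneg (fluidOccupancy_nonneg x _)]

theorem queueMean_waiting_le_dist {N : ℕ} (x : Fin N → ℕ) (c : ℝ) (K : ℕ) :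
    queueMean (waiting K) x ≤ dist (fluidStateL1 x) (lp.single (E := fun _ : ℕ => ℝ) 1 0 c) := by
  rw [dist_comm, dist_eq_norm, queueMean_waiting]
  have h := lp.sum_rpow_le_norm_rpow (p := 1) (by simp)
    (lp.single (E := fun _ : ℕ => ℝ) 1 0 c - fluidStateL1 x) (Finset.range (K + 1))
  simp only [ENNReal.toReal_one, Real.rpow_one] at h
  rw [Finset.sum_range_succ'] at h
  refine le_trans ?_ ((le_add_of_nonneg_right (norm_nonneg _)).trans h)
  refine le_of_eq (Finset.sum_congr rfl fun k _ => ?_)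
  simp [single_sub_fluidStateL1_apply, abs_of_nonneg (fluidOccupancy_nonneg x _)]

/-- Uniform closeness of all coordinates suffices for closeness in the product uniformity. -/
theorem exists_pos_forall_abs_lt_mem {V : Set ((ℕ → ℝ) × (ℕ → ℝ))} (hV : V ∈ 𝓤 (ℕ → ℝ)) :
    ∃ δ : ℝ, 0 < δ ∧ ∀ a c : ℕ → ℝ, (∀ k, |a k - c k| < δ) → (a, c) ∈ V := by
  rw [Pi.uniformity, Filter.mem_iInf'] at hV
  obtain ⟨I, hI, W, hW, -, rfl, -⟩ := hV
  have h1 : ∀ k, ∃ δ : ℝ, 0 < δ ∧ ∀ a c : ℕ → ℝ, |a k - c k| < δ → (a, c) ∈ W k := fun k => by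
    obtain ⟨U, hU, hUW⟩ := Filter.mem_comap.1 (hW k)
    obtain ⟨δ, hδ, h⟩ := Metric.mem_uniformity_dist.1 hU
    exact ⟨δ, hδ, fun a c hac => hUW (h hac)⟩
  choose δ hδ h using h1
  have h2 : ∀ᶠ e in 𝓝[>] (0 : ℝ), ∀ k ∈ hI.toFinset, e ≤ δ k :=
    (eventually_all_finset _).2 fun k _ => nhdsWithin_le_nhds (eventually_le_nhds (hδ k))
  obtain ⟨e, he, he'⟩ := (eventually_mem_nhdsWithin.and h2).exists
  exact ⟨e, he, fun a c hac => Set.mem_iInter₂.2 fun k hk =>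
    h k a c ((hac k).trans_le (he' k (hI.mem_toFinset.2 hk)))⟩

theorem measurable_toFun_of_isBatchJSQProcess {Ω : Type*} [mΩ : MeasurableSpace Ω] {P : Measure Ω}
    {N ℓ d : ℕ} {b : ℕ∞} {rate : ℝ} {X : Ω → SkorokhodSpace (Fin N → ℕ)}
    (hX : IsBatchJSQProcess P N ℓ d b rate X) (t : ℝ≥0) : Measurable fun ω => X ω t := by
  obtain ⟨-, sel, ℱ, -, hXm, -⟩ := hX
  exact (hXm t).mono (ℱ.le t) le_rfl

/-! ### The limit of many servers -/

/-- The probability of a deviation from the fluid limit is bounded by a null sequence, which does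
not depend on `K`, and by the probability of a deviation of the initial state. -/
theorem exists_tendsto_zero_measure_deviation_le {Ω : ℕ → Type*} [∀ N, MeasurableSpace (Ω N)]
    (P : ∀ N, Measure (Ω N)) [∀ N, IsProbabilityMeasure (P N)]
    (b : ℕ∞) (hb : 1 ≤ b)
    (ℓ d : ℕ → ℕ) (rate : ℕ → ℝ) (lam ε q₁ : ℝ)
    (hrate : ∀ N, 1 ≤ N → 0 ≤ rate N)
    (hℓ : ∀ N, 1 ≤ N → 1 ≤ ℓ N) (hℓd : ∀ N, 1 ≤ N → ℓ N ≤ d N) (hdN : ∀ N, 1 ≤ N → d N ≤ N)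
    (hrate_lim : Tendsto (fun N => rate N / N) atTop (𝓝 lam))
    (hℓ_lim : Tendsto ℓ atTop atTop)
    (hℓ_small : 0 < lam → Tendsto (fun N => (ℓ N : ℝ) / N) atTop (𝓝 0))
    (hε : 0 < ε) (hε' : ε < 1 - lam)
    (hd : ∀ᶠ N in atTop, (ℓ N : ℝ) / (1 - lam - ε) ≤ d N)
    (X : ∀ N, Ω N → SkorokhodSpace (Fin N → ℕ))
    (hX : ∀ N, 1 ≤ N → IsBatchJSQProcess (P N) N (ℓ N) (d N) b (rate N) (X N))
    (hq₁ : q₁ ≤ lam)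
    (hinit₁ : TendstoInProb P (fun N ω => fluidOccupancy (X N ω 0) 1) q₁)
    (hinit : TendstoInProb P (fun N ω => fluidOccupancy (X N ω 0) 2) 0)
    (T : ℝ≥0) {δ : ℝ} (hδ : 0 < δ) :
    ∃ η : ℝ, 0 < η ∧ ∃ β : ℕ → ℝ≥0∞, Tendsto β atTop (𝓝 0) ∧ ∀ᶠ N in atTop, ∀ K,
      P N {ω | ∃ t ≤ T, δ < |queueMean busy (X N ω t) - limitQ1 lam q₁ t| ∨
        δ < queueMean (waiting K) (X N ω t)} ≤
      β N + P N {ω | η < queueMean (waiting K) (X N ω 0)} := by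
  have hT : (0 : ℝ) ≤ T := T.2
  have hexp : 1 ≤ Real.exp T := Real.one_le_exp hT
  set A : ℝ := (2 + 3 * (T : ℝ) + (T : ℝ) ^ 2) * Real.exp T with hA
  have hA2 : 2 + (T : ℝ) ≤ A := by
    rw [hA]
    nlinarith [mul_nonneg hT (sub_nonneg.2 hexp), sq_nonneg (T : ℝ)]
  have hA0 : 0 < A := by linarith
  -- `A η` bounds the deviation from the limit; it must be at most `δ` and keep `q₁` below `λ + ε / 2`
  set η : ℝ := min δ (ε / 4) / A with hη
  have hη0 : 0 < η := by positivity
  have hAη : A * η = min δ (ε / 4) := by rw [hη]; field_simp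
  have hlam0 : 0 ≤ lam := by
    refine ge_of_tendsto hrate_lim ?_
    filter_upwards [eventually_ge_atTop 1] with N hN
    exact div_nonneg (hrate N hN) (by positivity)
  have hℓ_lim' : Tendsto (fun N => (ℓ N : ℝ)) atTop atTop :=
    tendsto_natCast_atTop_atTop.comp hℓ_lim
  -- the variance of the jumps vanishes
  have hκ : Tendsto (fun N : ℕ => (1 / (N : ℝ) + rate N / N * (ℓ N / N)) * T) atTop (𝓝 0) := by
    -- for `λ = 0` batches may be as large as the system, but then they are rare
    have h1 : Tendsto (fun N : ℕ => rate N / N * ((ℓ N : ℝ) / N)) atTop (𝓝 0) := by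
      rcases hlam0.eq_or_lt with h0 | h0
      · rw [← h0] at hrate_lim
        refine tendsto_of_tendsto_of_tendsto_of_le_of_le' tendsto_const_nhds hrate_lim ?_ ?_
        · filter_upwards [eventually_ge_atTop 1] with N hN
          have := hrate N hN
          positivity
        · filter_upwards [eventually_ge_atTop 1] with N hN
          have h2 := hrate N hN
          have h3 : (ℓ N : ℝ) / N ≤ 1 := by
            refine div_le_one_of_le₀ ?_ (by positivity)
            exact_mod_cast (hℓd N hN).trans (hdN N hN)
          exact mul_le_of_le_one_right (by positivity) h3
      · simpa using hrate_lim.mul (hℓ_small h0)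
    simpa using (tendsto_one_div_atTop_nhds_zero_nat.add h1).mul_const (T : ℝ)
  refine ⟨η, hη0, fun N => 3 * ENNReal.ofReal
      (√((1 / N + rate N / N * (ℓ N / N)) * T) / η) +
        P N {ω | η < |queueMean busy (X N ω 0) - q₁|} +
        P N {ω | η < queueMean (waiting 1) (X N ω 0)}, ?_, ?_⟩
  · have h1 : Tendsto (fun N : ℕ => 3 * ENNReal.ofReal
        (√((1 / (N : ℝ) + rate N / N * (ℓ N / N)) * T) / η)) atTop (𝓝 0) := by
      have h2 := (ENNReal.tendsto_ofReal ((hκ.sqrt).div_const η))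
      simp only [Real.sqrt_zero, zero_div, ENNReal.ofReal_zero] at h2
      have h3 := ENNReal.Tendsto.const_mul (a := 3) h2 (Or.inr (by simp))
      rwa [mul_zero] at h3
    have h2 : Tendsto (fun N => P N {ω | η < |queueMean busy (X N ω 0) - q₁|}) atTop (𝓝 0) := by
      refine tendsto_of_tendsto_of_tendsto_of_le_of_le tendsto_const_nhds (hinit₁ η hη0)
        (fun _ => zero_le) fun N => measure_mono fun ω hω => ?_
      change η ≤ dist (fluidOccupancy (X N ω 0) 1) q₁
      rw [Real.dist_eq, fluidOccupancy_one]
      exact le_of_lt hω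
    have h3 : Tendsto (fun N => P N {ω | η < queueMean (waiting 1) (X N ω 0)}) atTop (𝓝 0) := by
      refine tendsto_of_tendsto_of_tendsto_of_le_of_le tendsto_const_nhds (hinit η hη0)
        (fun _ => zero_le) fun N => measure_mono fun ω hω => ?_
      change η ≤ dist (fluidOccupancy (X N ω 0) 2) 0
      rw [Real.dist_eq, sub_zero, ← queueMean_waiting_one]
      exact (le_of_lt hω).trans (le_abs_self _)
    simpa using (h1.add h2).add h3
  · -- `ρ` is the least fraction of idle servers below the threshold, `1 + c` the oversampling factor
    set ρ : ℝ := 1 - (lam + ε / 2) with hρ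
    set c : ℝ := ε / 2 / (1 - lam - ε) with hc
    have hgap : 0 < 1 - lam - ε := by linarith
    have hc0 : 0 < c := by positivity
    have hρ0 : 0 < ρ := by rw [hρ]; linarith
    have hcρ : 1 + c = ρ / (1 - lam - ε) := by rw [hc, hρ]; field_simp; ring
    have hs : Tendsto (fun N => rate N / N * ((1 + c) / (4 * c) / ℓ N)) atTop (𝓝 0) := by
      simpa using hrate_lim.mul (tendsto_const_nhds.div_atTop hℓ_lim')
    filter_upwards [eventually_ge_atTop 1, hd, hs.eventually (eventually_le_nhds (half_pos hη0)),
      hrate_lim.eventually (Metric.ball_mem_nhds lam (half_pos hη0))] with N hN hdN' hsN hrN K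
    have hℓ0 : (0 : ℝ) < ℓ N := by exact_mod_cast hℓ N hN
    have hr0 := hrate N hN
    refine (measure_mono ?_).trans ((hX N hN).measure_deviation_le (thr := lam + ε / 2) hN
      (hdN N hN) (hℓ N hN) hr0 hb T hη0 hq₁ ?_ ?_ ?_ K)
    · rintro ω ⟨t, ht, h⟩
      refine ⟨t, ht, h.imp (fun h => lt_of_le_of_lt ?_ h) fun h => lt_of_le_of_lt ?_ h⟩
      · calc _ = A * η := by rw [hA]; ring
          _ ≤ δ := hAη ▸ min_le_left _ _
      · calc _ ≤ A * η := by gcongr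
          _ ≤ δ := hAη ▸ min_le_left _ _
    · calc _ = A * η := by rw [hA]; ring
        _ ≤ ε / 4 := hAη ▸ min_le_right _ _
        _ < lam + ε / 2 - lam := by linarith
    · exact le_of_lt hrN
    · intro x hx
      refine le_trans ?_ hsN
      have h1 : meanShortage (ℓ N) (d N) x ≤ (1 + c) / (4 * c) := by
        refine meanShortage_le hN (hdN N hN) (hℓ N hN) (ρ := ρ) hc0 ?_ (by rw [hρ]; linarith)
        calc (1 + c) * ℓ N = ℓ N / (1 - lam - ε) * ρ := by rw [hcρ]; ring
          _ ≤ d N * ρ := by gcongr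
      gcongr

end BatchJSQ

end

theorem mainTheorem6
    {Ω : ℕ → Type*} [∀ N, MeasurableSpace (Ω N)]
    (P : ∀ N, Measure (Ω N)) [∀ N, IsProbabilityMeasure (P N)]
    (b : ℕ∞) (hb : 1 ≤ b)
    (ℓ d : ℕ → ℕ) (rate : ℕ → ℝ) (lam ε q₁ : ℝ)
    (hrate : ∀ N, 1 ≤ N → 0 ≤ rate N)
    (hℓ : ∀ N, 1 ≤ N → 1 ≤ ℓ N) (hℓd : ∀ N, 1 ≤ N → ℓ N ≤ d N) (hdN : ∀ N, 1 ≤ N → d N ≤ N)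
    (hlam : lam < 1)
    (hrate_lim : Tendsto (fun N => rate N / N) atTop (𝓝 lam))
    (hℓ_lim : Tendsto ℓ atTop atTop)
    (hℓ_small : 0 < lam → Tendsto (fun N => (ℓ N : ℝ) / N) atTop (𝓝 0))
    (hε : 0 < ε) (hε' : ε < 1 - lam)
    (hd : ∀ᶠ N in atTop, (ℓ N : ℝ) / (1 - lam - ε) ≤ d N)
    (X : ∀ N, Ω N → BatchJSQ.SkorokhodSpace (Fin N → ℕ))
    (hX : ∀ N, 1 ≤ N → BatchJSQ.IsBatchJSQProcess (P N) N (ℓ N) (d N) b (rate N) (X N))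
    (hq₁ : q₁ ≤ lam)
    (hinit₁ : BatchJSQ.TendstoInProb P (fun N ω => BatchJSQ.fluidOccupancy (X N ω 0) 1) q₁)
    (hinit : ∀ i, 2 ≤ i →
      BatchJSQ.TendstoInProb P (fun N ω => BatchJSQ.fluidOccupancy (X N ω 0) i) 0) :
    -- weak convergence for the product topology on occupancy states
    TendstoInDistribution (fun N ω => BatchJSQ.fluidPath (X N ω)) atTop
      (fun _ : Unit => BatchJSQ.limitPath lam q₁) P (Measure.dirac ()) ∧
    -- weak convergence for the `ℓ₁` topology on occupancy states, for finite buffers, and for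
    -- infinite buffers if the initial states converge in `ℓ₁`
    ((b ≠ ⊤ ∨ BatchJSQ.TendstoInProb P (fun N ω => BatchJSQ.fluidStateL1 (X N ω 0))
        (BatchJSQ.limitPathL1 lam q₁ 0)) →
      TendstoInDistribution (fun N ω => BatchJSQ.fluidPathL1 (X N ω)) atTop
        (fun _ : Unit => BatchJSQ.limitPathL1 lam q₁) P (Measure.dirac ())) ∧
    -- the least admissible number of samples costs `O(1)` samples per task
    (∀ᶠ N in atTop, ℓ N ≤ ⌈(ℓ N : ℝ) / (1 - lam - ε)⌉₊ ∧ ⌈(ℓ N : ℝ) / (1 - lam - ε)⌉₊ ≤ N) ∧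
    Tendsto (fun N => (⌈(ℓ N : ℝ) / (1 - lam - ε)⌉₊ : ℝ) / ℓ N) atTop
      (𝓝 (1 - lam - ε)⁻¹) := by
  have hmeas : ∀ N t, Measurable fun ω => X N ω t := fun N t => by
    -- nothing is assumed about the system without servers, but it has only one state
    rcases Nat.eq_zero_or_pos N with rfl | hN
    · exact measurable_of_subsingleton_codomain _
    · exact BatchJSQ.measurable_toFun_of_isBatchJSQProcess (hX N hN) t
  have hdev := BatchJSQ.exists_tendsto_zero_measure_deviation_le P b hb ℓ d rate lam ε q₁ hrate hℓ
    hℓd hdN hrate_lim hℓ_lim hℓ_small hε hε' hd X hX hq₁ hinit₁ (hinit 2 le_rfl)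
  have hgap : 0 < 1 - lam - ε := by linarith
  have hlam0 : 0 ≤ lam := by
    refine ge_of_tendsto hrate_lim ?_
    filter_upwards [eventually_ge_atTop 1] with N hN
    exact div_nonneg (hrate N hN) (by positivity)
  refine ⟨?_, fun hinit' => ?_, ?_, ?_⟩
  · refine BatchJSQ.tendstoInDistribution_of_forall_entourage P
      (fun N => BatchJSQ.measurable_map_of_forall_measurable _ (hmeas N)) fun U hU => ?_
    obtain ⟨T, e, he, V, hV, hVU⟩ := hU
    obtain ⟨δ, hδ, hδV⟩ := BatchJSQ.exists_pos_forall_abs_lt_mem hV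
    obtain ⟨η, hη, β, hβ, hle⟩ := hdev T (half_pos hδ)
    have h1 : Tendsto (fun N => P N {ω | η < BatchJSQ.queueMean (BatchJSQ.waiting 1) (X N ω 0)})
        atTop (𝓝 0) := by
      refine tendsto_of_tendsto_of_tendsto_of_le_of_le tendsto_const_nhds (hinit 2 le_rfl η hη)
        (fun _ => zero_le) fun N => measure_mono fun ω hω => ?_
      change η ≤ dist (BatchJSQ.fluidOccupancy (X N ω 0) 2) 0
      rw [Real.dist_eq, sub_zero, ← BatchJSQ.queueMean_waiting_one]
      exact (le_of_lt hω).trans (le_abs_self _)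
    have h2 := hβ.add h1
    rw [add_zero] at h2
    refine tendsto_of_tendsto_of_tendsto_of_le_of_le' tendsto_const_nhds h2
      (Eventually.of_forall fun _ => zero_le) (hle.mono fun N hN => le_trans ?_ (hN 1))
    refine measure_mono fun ω hω => ?_
    by_contra hcon
    simp only [Set.mem_ofPred_eq, not_exists, not_and, not_or, not_lt] at hcon
    refine hω (hVU ⟨OrderIso.refl _, fun t ht => ⟨by simp, hδV _ _ fun k => ?_⟩⟩)
    obtain ⟨hc1, hc2⟩ := hcon t ht
    rcases k with _ | k
    · change |BatchJSQ.limitQ1 lam q₁ t - BatchJSQ.fluidOccupancy (X N ω t) 1| < δ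
      rw [BatchJSQ.fluidOccupancy_one, abs_sub_comm]
      linarith
    · change |0 - BatchJSQ.fluidOccupancy (X N ω t) (k + 2)| < δ
      rw [zero_sub, abs_neg, abs_of_nonneg (BatchJSQ.fluidOccupancy_nonneg _ _)]
      have := BatchJSQ.fluidOccupancy_add_two_le (X N ω t) k
      linarith
  · -- the waiting tasks are initially negligible, with or without a bound on the buffers
    have htail : ∀ η : ℝ, 0 < η → Tendsto (fun N => P N {ω | ∃ K, η <
        BatchJSQ.queueMean (BatchJSQ.waiting K) (X N ω 0)}) atTop (𝓝 0) := fun η hη => by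
      rcases hinit' with hb' | hL1
      · lift b to ℕ using hb'
        have hb0 : (0 : ℝ) < b := by exact_mod_cast (by exact_mod_cast hb : 1 ≤ b)
        refine tendsto_of_tendsto_of_tendsto_of_le_of_le' tendsto_const_nhds
          (hinit 2 le_rfl (η / b) (by positivity)) (Eventually.of_forall fun _ => zero_le) ?_
        filter_upwards [eventually_ge_atTop 1] with N hN
        refine measure_mono fun ω hω => ?_
        obtain ⟨K, hK⟩ := hω
        change η / b ≤ dist (BatchJSQ.fluidOccupancy (X N ω 0) 2) 0
        rw [Real.dist_eq, sub_zero, ← BatchJSQ.queueMean_waiting_one, div_le_iff₀' hb0]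
        have h1 := BatchJSQ.queueMean_waiting_le_mul (n := b) (x := X N ω 0)
          (fun j => by exact_mod_cast (hX N hN).1 ω 0 j) K
        exact (hK.le.trans h1).trans (mul_le_mul_of_nonneg_left (le_abs_self _) hb0.le)
      · refine tendsto_of_tendsto_of_tendsto_of_le_of_le tendsto_const_nhds (hL1 η hη)
          (fun _ => zero_le) fun N => measure_mono fun ω hω => ?_
        obtain ⟨K, hK⟩ := hω
        exact hK.le.trans (BatchJSQ.queueMean_waiting_le_dist _ _ K)
    refine BatchJSQ.tendstoInDistribution_of_forall_entourage P
      (fun N => BatchJSQ.measurable_map_of_forall_measurable _ (hmeas N)) fun U hU => ?_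
    obtain ⟨T, e, he, V, hV, hVU⟩ := hU
    obtain ⟨δ, hδ, hδV⟩ := Metric.mem_uniformity_dist.1 hV
    obtain ⟨η, hη, β, hβ, hle⟩ := hdev T (by positivity : 0 < δ / 3)
    have h2 := hβ.add (htail η hη)
    rw [add_zero] at h2
    refine tendsto_of_tendsto_of_tendsto_of_le_of_le' tendsto_const_nhds h2
      (Eventually.of_forall fun _ => zero_le) (hle.mono fun N hN => ?_)
    -- the bound does not depend on `K`, so that it holds for the increasing union over `K`
    let S : ℕ → Set (Ω N) := fun K => {ω | ∃ t ≤ T,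
      δ / 3 < |BatchJSQ.queueMean BatchJSQ.busy (X N ω t) - BatchJSQ.limitQ1 lam q₁ t| ∨
        δ / 3 < BatchJSQ.queueMean (BatchJSQ.waiting K) (X N ω t)}
    have hS : Monotone S := fun K K' hK ω => by
      rintro ⟨t, ht, h⟩
      exact ⟨t, ht, h.imp_right fun h => h.trans_le (BatchJSQ.queueMean_waiting_mono _ hK)⟩
    calc _ ≤ P N (⋃ K, S K) := by
          refine measure_mono fun ω hω => ?_
          by_contra hcon
          simp only [S, Set.mem_iUnion, Set.mem_ofPred_eq, not_exists, not_and, not_or, not_lt]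
            at hcon
          refine hω (hVU ⟨OrderIso.refl _, fun t ht => ⟨by simp, hδV ?_⟩⟩)
          have h3 := BatchJSQ.dist_single_fluidStateL1_le (hcon 0 t ht).1
            fun K => (hcon K t ht).2
          change dist (lp.single (E := fun _ : ℕ => ℝ) 1 0 (BatchJSQ.limitQ1 lam q₁ t))
            (BatchJSQ.fluidStateL1 (X N ω t)) < δ
          linarith
      _ = ⨆ K, P N (S K) := hS.measure_iUnion
      _ ≤ _ := iSup_le fun K => (hN K).trans
          (add_le_add le_rfl (measure_mono fun ω hω => by exact ⟨K, hω⟩))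
  · filter_upwards [eventually_ge_atTop 1, hd] with N hN hdN'
    refine ⟨?_, (Nat.ceil_le.2 hdN').trans (hdN N hN)⟩
    have h1 : (ℓ N : ℝ) ≤ ℓ N / (1 - lam - ε) := by
      rw [le_div_iff₀ hgap]
      exact mul_le_of_le_one_right (by positivity) (by linarith)
    exact_mod_cast h1.trans (Nat.le_ceil _)
  · have h1 := (tendsto_nat_ceil_mul_div_atTop (inv_nonneg.2 hgap.le)).comp
      (tendsto_natCast_atTop_atTop.comp hℓ_lim)
    refine h1.congr fun N => ?_
    simp only [Function.comp_apply, div_eq_inv_mul]
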